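/- Write $\mathbf J_n$ for the $n\times n$ nilpotent Jordan block (ones on the first superdiagonal). For positive integers $q_1,\dots,q_N$ put $\mathbf A^\star(q)=\mathrm{diag}(\mathbf J_{q_1},\dots,\mathbf J_{q_N})$, $\mathbf B(q)=\mathrm{diag}(\mathbf B_{q_1},\dots,\mathbf B_{q_N})$ with $\mathbf B_{q_i}=(0,\dots,0,1)^\top\in\mathbb R^{q_i}$, and $\mathbf C(q)=\mathrm{diag}(\mathbf C_{q_1},\dots,\mathbf C_{q_N})$ with $\mathbf C_{q_i}=(1,0,\dots,0)\in\mathbb R^{1\times q_i}$. The $q_i$ coordinates of the $i$-th block are called chain $i$. A real linear system $\dot x=Ax+Bu$, $y=Cx+Du$ is in *special coordinate basis (SCB)* form if, for some partition of its coordinates $x=(x_a,x_b,x_c,x_d)$, $u=(u_0,u_d,u_c)$, $y=(y_0,y_d,y_b)$ with dimensions $(n_a,n_b,n_c,n_d)$, $(m_0,m_d,m_c)$, $(m_0,m_d,p_b)$ (any of which may be $0$), some positive integers $l_1,\dots,l_{p_b}$ with sum $n_b$ and $q_1\ge q_2\ge\dots\ge q_{m_d}\ge 1$ with sum $n_d$,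 and some real matrices of matching sizes, $$A=\begin{bmatrix}A_a&H_{ab}C_b&0&H_{ad}C_d\\0&A_b&0&H_{bd}C_d\\B_cF_{ca}&H_{cb}C_b&A_c&H_{cd}C_d\\B_dF_{da}&B_dF_{db}&B_dF_{dc}&A_d\end{bmatrix}+\begin{bmatrix}B_{0a}\\B_{0b}\\B_{0c}\\B_{0d}\end{bmatrix}\begin{bmatrix}C_{0a}&C_{0b}&C_{0c}&C_{0d}\end{bmatrix},\qquad B=\begin{bmatrix}B_{0a}&0&0\\B_{0b}&0&0\\B_{0c}&0&B_c\\B_{0d}&B_d&0\end{bmatrix},$$ $$C=\begin{bmatrix}C_{0a}&C_{0b}&C_{0c}&C_{0d}\\0&0&0&C_d\\0&C_b&0&0\end{bmatrix},\qquad D=\begin{bmatrix}I_{m_0}&0&0\\0&0&0\\0&0&0\end{bmatrix},$$ where $C_b=\mathbf C(l)$, $A_b=\mathbf A^\star(l)+H_{bb}C_b$, $B_d=\mathbf B(q)$, $C_d=\mathbf C(q)$ and $A_d=\mathbf A^\star(q)+B_dF_{dd}+H_{dd}C_d$. Say that $F_{dd}\in\mathbb R^{m_d\times n_d}$ has *structure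 (F)* if, for each $i$, every entry of row $i$ of $F_{dd}$ is zero except possibly those in the columns that belong to the second, third, … components of the chains $1,\dots,i-1$. (In particular the first row, and every column that belongs to the first component of a chain, vanishes.) **Theorem.** 1. Let $A\in\mathbb R^{n\times n}$, $B\in\mathbb R^{n\times m}$, $C\in\mathbb R^{p\times n}$, $D\in\mathbb R^{p\times m}$ with $\operatorname{rank}D=m_0$, $\operatorname{rank}[B^\top\ D^\top]=m$ and $\operatorname{rank}[C\ D]=p$. Then there are nonsingular state, input and output transformations $x=T_s\bar x$, $u=T_i\bar u$, $y=T_o\bar y$ that take the system to an SCB form in which $F_{dd}$ has structure (F). In this form $A_d-H_{dd}C_d=\mathbf A^\star(q)+B_dF_{dd}$ is block lower triangular with respect to the partition of $x_d$ into chains. 2. If a system is already in an SCB form, then there is a nonsingular matrix $T_d\in\mathbb R^{n_d\times n_d}$ with $C_dT_d=C_d$ and $T_d^{-1}B_d=B_d$ such that the state transformation $x=T_s\bar x$ with $T_s=\mathrm{diag}(I_{n_a},I_{n_b},I_{n_c},T_d)$ (inputs and outputs unchanged) takes the system to an SCB form with the same chain lengths $l_i$, $q_i$, in which $F_{dd}$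 and $H_{dd}$ are replaced by some $\bar F_{dd}$, $\bar H_{dd}$, where $\bar F_{dd}$ has structure (F), $B_{0d}$ by $T_d^{-1}B_{0d}$, $C_{0d}$ by $C_{0d}T_d$, and all other matrices are unchanged. Again $\bar A_d-\bar H_{dd}C_d$, with $\bar A_d$ the new $A_d$, is block lower triangular with respect to the partition into chains. -/

import Mathlib

open Matrix

/-- A linear time-invariant system `x' = A x + B u`, `y = C x + D u`, with state, input and output
coordinates indexed by `X`, `U` and `Y`. -/
structure LTISystem (X U Y : Type*) where
  A : Matrix X X ℝ
  B : Matrix X U ℝ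
  C : Matrix Y X ℝ
  D : Matrix Y U ℝ

/-- A change-of-coordinates matrix between two coordinate index sets is nonsingular if it has a
two-sided inverse (so that the index sets have the same cardinality). -/
def IsNonsingular {α β : Type*} [Fintype α] [Fintype β] [DecidableEq α] [DecidableEq β]
    (T : Matrix α β ℝ) : Prop :=
  ∃ S : Matrix β α ℝ, T * S = 1 ∧ S * T = 1

/-- The nonsingular state, input and output transformations `x = Ts x'`, `u = Ti u'`, `y = To y'`
take the system `S` to the system `S'`, i.e. `A' = Ts⁻¹ A Ts`, `B' = Ts⁻¹ B Ti`,
`C' = To⁻¹ C Ts` and `D' = To⁻¹ D Ti`. -/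
structure LTISystem.TransformsTo {X U Y X' U' Y' : Type*}
    [Fintype X] [Fintype U] [Fintype Y] [Fintype X'] [Fintype U'] [Fintype Y']
    [DecidableEq X] [DecidableEq U] [DecidableEq Y]
    [DecidableEq X'] [DecidableEq U'] [DecidableEq Y']
    (S : LTISystem X U Y) (Ts : Matrix X X' ℝ) (Ti : Matrix U U' ℝ) (To : Matrix Y Y' ℝ)
    (S' : LTISystem X' U' Y') : Prop where
  state_nonsingular : IsNonsingular Ts
  input_nonsingular : IsNonsingular Ti
  output_nonsingular : IsNonsingular To
  eq_A : S.A * Ts = Ts * S'.A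
  eq_B : S.B * Ti = Ts * S'.B
  eq_C : S.C * Ts = To * S'.C
  eq_D : S.D * Ti = To * S'.D

/-- Coordinates of `N` concatenated chains of lengths `q 0, …, q (N - 1)`: the pair `⟨i, k⟩` is
the `k`-th component of chain `i` (both counted from zero). -/
abbrev ChainIdx {N : ℕ} (q : Fin N → ℕ) : Type := Σ i : Fin N, Fin (q i)

/-- The nilpotent Jordan block `J_n`, with ones on the first superdiagonal. -/
def jordanBlock (n : ℕ) : Matrix (Fin n) (Fin n) ℝ :=
  Matrix.of fun k j => if (k : ℕ) + 1 = (j : ℕ) then 1 else 0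

/-- `diag(J_{q_1}, …, J_{q_N})`. -/
def chainA {N : ℕ} (q : Fin N → ℕ) : Matrix (ChainIdx q) (ChainIdx q) ℝ :=
  Matrix.blockDiagonal' fun i => jordanBlock (q i)

/-- `diag(B_{q_1}, …, B_{q_N})`, where `B_{q_i}` is the last standard basis column vector. -/
def chainB {N : ℕ} (q : Fin N → ℕ) : Matrix (ChainIdx q) (Fin N) ℝ :=
  Matrix.of fun c j => if c.1 = j ∧ (c.2 : ℕ) + 1 = q c.1 then 1 else 0

/-- `diag(C_{q_1}, …, C_{q_N})`, where `C_{q_i}` is the first standard basis row vector. -/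
def chainC {N : ℕ} (q : Fin N → ℕ) : Matrix (Fin N) (ChainIdx q) ℝ :=
  Matrix.of fun j c => if c.1 = j ∧ (c.2 : ℕ) = 0 then 1 else 0

/-- State coordinates `(x_a, x_b, x_c, x_d)`. -/
abbrev SCBState (na nc : ℕ) {pb md : ℕ} (l : Fin pb → ℕ) (q : Fin md → ℕ) : Type :=
  Fin na ⊕ ChainIdx l ⊕ Fin nc ⊕ ChainIdx q

/-- Input coordinates `(u_0, u_d, u_c)`. -/
abbrev SCBInput (m₀ md mc : ℕ) : Type := Fin m₀ ⊕ Fin md ⊕ Fin mc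

/-- Output coordinates `(y_0, y_d, y_b)`. -/
abbrev SCBOutput (m₀ md pb : ℕ) : Type := Fin m₀ ⊕ Fin md ⊕ Fin pb

/-- The free matrices of a special coordinate basis whose subsystem (b) has chain lengths `l` and
whose subsystem (d) has chain lengths `q`. -/
structure SCBData (m₀ na nc mc : ℕ) {pb md : ℕ} (l : Fin pb → ℕ) (q : Fin md → ℕ) where
  Aa : Matrix (Fin na) (Fin na) ℝ
  Hab : Matrix (Fin na) (Fin pb) ℝ
  Had : Matrix (Fin na) (Fin md) ℝ
  Hbb : Matrix (ChainIdx l) (Fin pb) ℝ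
  Hbd : Matrix (ChainIdx l) (Fin md) ℝ
  Ac : Matrix (Fin nc) (Fin nc) ℝ
  Bc : Matrix (Fin nc) (Fin mc) ℝ
  Fca : Matrix (Fin mc) (Fin na) ℝ
  Hcb : Matrix (Fin nc) (Fin pb) ℝ
  Hcd : Matrix (Fin nc) (Fin md) ℝ
  Fda : Matrix (Fin md) (Fin na) ℝ
  Fdb : Matrix (Fin md) (ChainIdx l) ℝ
  Fdc : Matrix (Fin md) (Fin nc) ℝ
  Fdd : Matrix (Fin md) (ChainIdx q) ℝ
  Hdd : Matrix (ChainIdx q) (Fin md) ℝ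
  B0a : Matrix (Fin na) (Fin m₀) ℝ
  B0b : Matrix (ChainIdx l) (Fin m₀) ℝ
  B0c : Matrix (Fin nc) (Fin m₀) ℝ
  B0d : Matrix (ChainIdx q) (Fin m₀) ℝ
  C0a : Matrix (Fin m₀) (Fin na) ℝ
  C0b : Matrix (Fin m₀) (ChainIdx l) ℝ
  C0c : Matrix (Fin m₀) (Fin nc) ℝ
  C0d : Matrix (Fin m₀) (ChainIdx q) ℝ

namespace SCBData

variable {m₀ na nc mc pb md : ℕ} {l : Fin pb → ℕ} {q : Fin md → ℕ}

/-- `A_b = A_b* + H_bb C_b`. -/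
def Ab (Φ : SCBData m₀ na nc mc l q) : Matrix (ChainIdx l) (ChainIdx l) ℝ :=
  chainA l + Φ.Hbb * chainC l

/-- `A_d = A_d* + B_d F_dd + H_dd C_d`. -/
def Ad (Φ : SCBData m₀ na nc mc l q) : Matrix (ChainIdx q) (ChainIdx q) ℝ :=
  chainA q + chainB q * Φ.Fdd + Φ.Hdd * chainC q

/-- The block column `(B_0a, B_0b, B_0c, B_0d)`. -/
def B0 (Φ : SCBData m₀ na nc mc l q) : Matrix (SCBState na nc l q) (Fin m₀) ℝ :=
  fromRows Φ.B0a (fromRows Φ.B0b (fromRows Φ.B0c Φ.B0d))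

/-- The block row `(C_0a, C_0b, C_0c, C_0d)`. -/
def C0 (Φ : SCBData m₀ na nc mc l q) : Matrix (Fin m₀) (SCBState na nc l q) ℝ :=
  fromCols Φ.C0a (fromCols Φ.C0b (fromCols Φ.C0c Φ.C0d))

/-- The system in special coordinate basis form with the given data. -/
def toSystem (Φ : SCBData m₀ na nc mc l q) :
    LTISystem (SCBState na nc l q) (SCBInput m₀ md mc) (SCBOutput m₀ md pb) where
  A :=
    fromRows
      (fromCols Φ.Aa (fromCols (Φ.Hab * chainC l) (fromCols 0 (Φ.Had * chainC q))))
    (fromRows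
      (fromCols 0 (fromCols Φ.Ab (fromCols 0 (Φ.Hbd * chainC q))))
    (fromRows
      (fromCols (Φ.Bc * Φ.Fca) (fromCols (Φ.Hcb * chainC l) (fromCols Φ.Ac (Φ.Hcd * chainC q))))
      (fromCols (chainB q * Φ.Fda)
        (fromCols (chainB q * Φ.Fdb) (fromCols (chainB q * Φ.Fdc) Φ.Ad)))))
    + Φ.B0 * Φ.C0
  B :=
    fromRows (fromCols Φ.B0a (fromCols 0 0))
    (fromRows (fromCols Φ.B0b (fromCols 0 0))
    (fromRows (fromCols Φ.B0c (fromCols 0 Φ.Bc))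
      (fromCols Φ.B0d (fromCols (chainB q) 0))))
  C :=
    fromRows (fromCols Φ.C0a (fromCols Φ.C0b (fromCols Φ.C0c Φ.C0d)))
    (fromRows (fromCols 0 (fromCols 0 (fromCols 0 (chainC q))))
      (fromCols 0 (fromCols (chainC l) (fromCols 0 0))))
  D :=
    fromRows (fromCols 1 (fromCols 0 0))
    (fromRows (fromCols 0 (fromCols 0 0))
      (fromCols 0 (fromCols 0 0)))

end SCBData

/-- The particular structure of `F_dd`: row `i` has nonzero entries only in the columns that belong
to the chains `j < i`, and none in the column of the first component of a chain. -/
def IsStrictlyBlockLower {md : ℕ} {q : Fin md → ℕ} (F : Matrix (Fin md) (ChainIdx q) ℝ) : Prop :=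
  ∀ (i j : Fin md) (k : Fin (q j)), i ≤ j ∨ (k : ℕ) = 0 → F i ⟨j, k⟩ = 0

/-- Block lower triangularity with respect to the partition of the coordinates into chains. -/
def IsBlockLower {md : ℕ} {q : Fin md → ℕ} (M : Matrix (ChainIdx q) (ChainIdx q) ℝ) : Prop :=
  M.BlockTriangular fun c => OrderDual.toDual c.1

/-- `diag(I, I, I, T_d)`. -/
def subsystemDTransformation (na nc : ℕ) {pb md : ℕ} (l : Fin pb → ℕ) {q : Fin md → ℕ}
    (Td : Matrix (ChainIdx q) (ChainIdx q) ℝ) :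
    Matrix (SCBState na nc l q) (SCBState na nc l q) ℝ :=
  fromBlocks 1 0 0 (fromBlocks 1 0 0 (fromBlocks 1 0 0 Td))

/-! ### Chain matrices and the normalisation of the feedback between chains -/

section ChainMatrices

variable {N : ℕ} {q : Fin N → ℕ}

/-! There are two independent arguments: one normalises $F_{dd}$ inside a given SCB, the other
constructs an SCB from scratch.

Normalisation. A matrix `M` that is constant along the diagonals of each block commutes with
$\mathbf A^\star$ except in the last row of each chain and the first column of each chain. If the
band of `M` is placed so that the defect in the last rows is exactly the unwanted part of $F_{dd}$
in the columns of component `K`, then conjugation by `1 - M` removes that part, and the defect in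
the first columns is an output injection. The order $q_1\ge q_2\ge\dots$ places the band strictly
below the diagonal of every block that is used, so `1 - M` is unipotent and fixes $B_d$ and $C_d$.
Components are cleared from the highest to the lowest (`exists_chainEquiv_vanishesFrom`); the first
components are themselves output injections.

Construction. Everything is dual: a state coordinate is a row vector `x`, its derivative is `x A`,
and a basis of row vectors is a change of coordinates. After the feedthrough has been split off, let
`Y` be the space of output covectors and `N` that of covectors whose derivative contains no
remaining input. Pass to a complement of `Y`, with the derivatives of `Y ⊓ N` as new outputs, and
recurse on the dimension (`exists_chainDecomposition`). On the way back each chain gains a new head,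
an output whose derivative is the old head. When no outputs are left, all that remains is $x_a$ and
$x_c$ together. These are separated by `exists_invariant_splitting`, and
`ChainDecomposition.exists_correction` removes the outputs $y_b$ from the chains (d).
`exists_scb_bases` and `exists_scbData` turn the covectors into bases and matrices. -/

lemma chainA_apply (c d : ChainIdx q) :
    chainA q c d = if c.1 = d.1 ∧ (c.2 : ℕ) + 1 = d.2 then 1 else 0 := by
  obtain ⟨i, r⟩ := c
  obtain ⟨j, k⟩ := d
  by_cases h : i = j
  · subst h
    simp [chainA, jordanBlock]
  · simp [chainA, Matrix.blockDiagonal'_apply, h]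

lemma chainA_mul_apply {α : Type*} (M : Matrix (ChainIdx q) α ℝ) (i : Fin N) (r : Fin (q i))
    (d : α) :
    (chainA q * M) ⟨i, r⟩ d = if h : (r : ℕ) + 1 < q i then M ⟨i, ⟨r + 1, h⟩⟩ d else 0 := by
  rw [Matrix.mul_apply]
  split_ifs with h
  · rw [Finset.sum_eq_single ⟨i, ⟨r + 1, h⟩⟩]
    · simp [chainA_apply]
    · rintro ⟨j, k⟩ - hne
      rw [chainA_apply, if_neg, zero_mul]
      rintro ⟨rfl, hk⟩
      exact hne (by congr; exact Fin.ext hk.symm)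
    · simp
  · refine Finset.sum_eq_zero ?_
    rintro ⟨j, k⟩ -
    rw [chainA_apply, if_neg, zero_mul]
    rintro ⟨rfl, hk⟩
    exact h (by have := k.2; simp only at hk; omega)

lemma mul_chainA_apply_zero {α : Type*} (M : Matrix α (ChainIdx q) ℝ) (c : α) (j : Fin N)
    (k : Fin (q j)) (hk : (k : ℕ) = 0) : (M * chainA q) c ⟨j, k⟩ = 0 := by
  rw [Matrix.mul_apply]
  refine Finset.sum_eq_zero fun d _ => ?_
  rw [chainA_apply, if_neg, mul_zero]
  rintro ⟨-, h⟩
  simp only at h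
  omega

lemma mul_chainA_apply_succ {α : Type*} (M : Matrix α (ChainIdx q) ℝ) (c : α) (j : Fin N)
    (k : ℕ) (hk : k + 1 < q j) :
    (M * chainA q) c ⟨j, ⟨k + 1, hk⟩⟩ = M c ⟨j, ⟨k, by omega⟩⟩ := by
  rw [Matrix.mul_apply, Finset.sum_eq_single ⟨j, ⟨k, by omega⟩⟩]
  · simp [chainA_apply]
  · rintro ⟨j', k'⟩ - hne
    rw [chainA_apply, if_neg, mul_zero]
    rintro ⟨rfl, hk'⟩
    exact hne (by congr; exact Fin.ext (by simpa using hk'))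
  · simp

lemma chainB_mul_apply {α : Type*} (F : Matrix (Fin N) α ℝ) (i : Fin N) (r : Fin (q i)) (d : α) :
    (chainB q * F) ⟨i, r⟩ d = if (r : ℕ) + 1 = q i then F i d else 0 := by
  rw [Matrix.mul_apply, Finset.sum_eq_single i]
  · simp [chainB]
  · intro j _ hne
    simp [chainB, hne.symm]
  · simp

lemma mul_chainB_apply {α : Type*} (M : Matrix α (ChainIdx q) ℝ) (c : α) (j : Fin N)
    (hq : 0 < q j) : (M * chainB q) c j = M c ⟨j, ⟨q j - 1, by omega⟩⟩ := by
  rw [Matrix.mul_apply, Finset.sum_eq_single ⟨j, ⟨q j - 1, by omega⟩⟩]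
  · simp [chainB, Nat.sub_add_cancel hq]
  · rintro ⟨j', k'⟩ - hne
    simp only [chainB, of_apply]
    rw [if_neg, mul_zero]
    rintro ⟨rfl, hk'⟩
    exact hne (by congr; exact Fin.ext (by simp; omega))
  · simp

lemma mul_chainC_apply {α : Type*} (H : Matrix α (Fin N) ℝ) (c : α) (j : Fin N) (k : Fin (q j)) :
    (H * chainC q) c ⟨j, k⟩ = if (k : ℕ) = 0 then H c j else 0 := by
  rw [Matrix.mul_apply, Finset.sum_eq_single j]
  · simp [chainC]
  · intro i _ hne
    simp [chainC, hne.symm]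
  · simp

lemma chainC_mul_apply {α : Type*} (M : Matrix (ChainIdx q) α ℝ) (i : Fin N) (d : α)
    (hq : 0 < q i) : (chainC q * M) i d = M ⟨i, ⟨0, hq⟩⟩ d := by
  rw [Matrix.mul_apply, Finset.sum_eq_single ⟨i, ⟨0, hq⟩⟩]
  · simp [chainC]
  · rintro ⟨j, k⟩ - hne
    simp only [chainC, of_apply]
    rw [if_neg, zero_mul]
    rintro ⟨rfl, hk⟩
    exact hne (by congr; exact Fin.ext hk)
  · simp

/-- The shift by which a change of coordinates `1 - M` cancels the entries of `F` in the columns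
of the components `K` of the chains `j ≥ i`. -/
def chainShift (F : Matrix (Fin N) (ChainIdx q) ℝ) (K : ℕ) :
    Matrix (ChainIdx q) (ChainIdx q) ℝ :=
  Matrix.of fun c d => if h : K < q d.1 then
    if c.1 ≤ d.1 ∧ (d.2 : ℕ) + q c.1 = K + c.2 then F c.1 ⟨d.1, ⟨K, h⟩⟩ else 0 else 0

lemma chainShift_eq_zero (F : Matrix (Fin N) (ChainIdx q) ℝ) (K : ℕ) (c d : ChainIdx q)
    (h : K ≤ d.2) : chainShift F K c d = 0 := by
  simp only [chainShift, of_apply]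
  split_ifs with h1 h2
  · have := c.2.2
    omega
  · rfl
  · rfl

/-- A nonzero entry needs `c.1 ≤ d.1` and `K < q d.1 ≤ q c.1`, hence `d.2 < c.2`. This is where the
ordering of the chain lengths is indispensable. -/
lemma chainShift_eq_zero_of_le (hq : Antitone q) (F : Matrix (Fin N) (ChainIdx q) ℝ) (K : ℕ)
    (c d : ChainIdx q) (h : (c.2 : ℕ) ≤ d.2) : chainShift F K c d = 0 := by
  simp only [chainShift, of_apply]
  split_ifs with h1 h2
  · have := hq h2.1
    omega
  · rfl
  · rfl

/-- `F` has no entries `(i, (j, k))` with `i ≤ j` and `K ≤ k`. -/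
def VanishesFrom (F : Matrix (Fin N) (ChainIdx q) ℝ) (K : ℕ) : Prop :=
  ∀ (i j : Fin N) (k : Fin (q j)), i ≤ j → K ≤ (k : ℕ) → F i ⟨j, k⟩ = 0

/-- The change of coordinates `T` of the chains, together with output injection, replaces the
feedback `F` by `F'`. -/
structure ChainEquiv (F F' : Matrix (Fin N) (ChainIdx q) ℝ)
    (T : Matrix (ChainIdx q) (ChainIdx q) ℝ) (H : Matrix (ChainIdx q) (Fin N) ℝ) : Prop where
  isUnit_det : IsUnit T.det
  chainC_mul : chainC q * T = chainC q
  mul_chainB : T * chainB q = chainB q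
  conj : (chainA q + chainB q * F) * T = T * (chainA q + chainB q * F' + H * chainC q)

/-- The first output injection passes through the second change of coordinates because `T'` fixes
`chainC q`. -/
lemma ChainEquiv.trans {F F' F'' : Matrix (Fin N) (ChainIdx q) ℝ}
    {T T' : Matrix (ChainIdx q) (ChainIdx q) ℝ} {H H' : Matrix (ChainIdx q) (Fin N) ℝ}
    (h : ChainEquiv F F' T H) (h' : ChainEquiv F' F'' T' H') :
    ChainEquiv F F'' (T * T') (H' + T'⁻¹ * H) where
  isUnit_det := by
    rw [det_mul]
    exact h.isUnit_det.mul h'.isUnit_det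
  chainC_mul := by rw [← Matrix.mul_assoc, h.chainC_mul, h'.chainC_mul]
  mul_chainB := by rw [Matrix.mul_assoc, h'.mul_chainB, h.mul_chainB]
  conj := by
    have e : T' * (T'⁻¹ * H * chainC q) = H * chainC q * T' := by
      rw [Matrix.mul_assoc, ← Matrix.mul_assoc T', Matrix.mul_nonsing_inv _ h'.isUnit_det,
        Matrix.one_mul, Matrix.mul_assoc, h'.chainC_mul]
    rw [← Matrix.mul_assoc, h.conj, Matrix.mul_assoc, Matrix.add_mul _ (H * chainC q), h'.conj,
      ← e, ← Matrix.mul_add, Matrix.mul_assoc T]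
    congr 2
    rw [Matrix.add_mul, add_assoc]

/-- With `M = chainShift F K`, the commutator of `chainA q` and `M` is supported in the last row and
the first column of each chain. The last rows cancel the entries of `F` at component `K`; the first
columns go into `H`. Columns of components `≥ K` of `M` vanish, so nothing that was already cleared
comes back. -/
lemma exists_chainEquiv_vanishesFrom (hq0 : ∀ i, 0 < q i) (hq : Antitone q)
    (F : Matrix (Fin N) (ChainIdx q) ℝ) (K : ℕ) (hF : VanishesFrom F (K + 1)) :
    ∃ F' T H, ChainEquiv F F' T H ∧ VanishesFrom F' K := by
  set M := chainShift F K with hM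
  set S : Matrix (ChainIdx q) (ChainIdx q) ℝ := 1 - M with hS
  have hdet : S.det = 1 := by
    -- `S` is unipotent for the grading of the coordinates by their position in the chain,
    -- irrespective of the chain.
    have hbt : S.BlockTriangular fun c : ChainIdx q => OrderDual.toDual (c.2 : ℕ) := by
      intro c d hcd
      have hcd' : (c.2 : ℕ) < d.2 := hcd
      have hne : c ≠ d := by
        rintro rfl
        exact lt_irrefl _ hcd'
      simp [hS, hM, Matrix.one_apply_ne hne, chainShift_eq_zero_of_le hq F K c d hcd'.le]
    rw [hbt.det]
    refine Finset.prod_eq_one fun k _ => ?_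
    have : S.toSquareBlock (fun c : ChainIdx q => OrderDual.toDual (c.2 : ℕ)) k = 1 := by
      ext ⟨c, hc⟩ ⟨d, hd⟩
      have hcd : (c.2 : ℕ) ≤ d.2 := le_of_eq (by simpa using hc.trans hd.symm)
      simp only [Matrix.toSquareBlock_def, of_apply, hS, hM, Matrix.sub_apply,
        chainShift_eq_zero_of_le hq F K c d hcd, sub_zero]
      simp [Matrix.one_apply]
    rw [this, det_one]
  have hu : IsUnit S.det := by simp [hdet]
  set F1 : Matrix (Fin N) (ChainIdx q) ℝ :=
    Matrix.of fun i d => if i ≤ d.1 ∧ (d.2 : ℕ) = K then 0 else F i d with hF1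
  -- `H` collects whatever stands in the first columns of the identity `key`; there `M * chainA q`
  -- vanishes.
  set H : Matrix (ChainIdx q) (Fin N) ℝ := Matrix.of fun c j =>
    (chainA q * M + chainB q * F - chainB q * F1) c ⟨j, ⟨0, hq0 j⟩⟩ with hH
  have hMB : M * chainB q = 0 := by
    ext c j
    rw [mul_chainB_apply _ _ _ (hq0 j)]
    by_cases h : K < q j
    · exact chainShift_eq_zero _ _ _ _ (by simp; omega)
    · simp [hM, chainShift, h]
  have hCM : chainC q * M = 0 := by
    ext i d
    rw [chainC_mul_apply _ _ _ (hq0 i)]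
    exact chainShift_eq_zero_of_le hq _ _ _ _ (by simp)
  have key : chainA q * M - M * chainA q + chainB q * F = chainB q * F1 + H * chainC q := by
    ext ⟨i, r⟩ ⟨j, k⟩
    obtain ⟨k, hk⟩ := k
    rcases k with _ | k
    · simp only [Matrix.add_apply, Matrix.sub_apply, mul_chainC_apply,
        mul_chainA_apply_zero M ⟨i, r⟩ j ⟨0, hk⟩ rfl, hH, of_apply, if_true]
      ring
    · simp only [Matrix.add_apply, Matrix.sub_apply, mul_chainC_apply, mul_chainA_apply_succ,
        chainB_mul_apply, chainA_mul_apply]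
      rw [if_neg (Nat.succ_ne_zero k), add_zero]
      -- In a last row only `M * chainA q` survives from the commutator, and it meets `F` exactly at
      -- component `K`. In any other row both products read the same diagonal of `M`.
      by_cases hr : (r : ℕ) + 1 = q i
      · rw [dif_neg (by omega), if_pos hr, if_pos hr]
        simp only [hM, chainShift, hF1, of_apply]
        by_cases h1 : i ≤ j
        · by_cases h2 : k + 1 = K
          · subst h2
            rw [dif_pos hk, if_pos ⟨h1, by omega⟩, if_pos ⟨h1, rfl⟩]
            ring
          · have h3 : ¬ (k + q i = K + r) := by omega
            simp [h2, h3]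
        · simp [h1]
      · have := r.2
        rw [dif_pos (by omega), if_neg hr, if_neg hr]
        simp only [hM, chainShift, of_apply]
        have : (k + 1 + q i = K + (r + 1)) ↔ (k + q i = K + r) := by omega
        simp [this]
  have hSB : S * chainB q = chainB q := by rw [hS, Matrix.sub_mul, hMB, Matrix.one_mul, sub_zero]
  have hCS : chainC q * S = chainC q := by rw [hS, Matrix.mul_sub, hCM, Matrix.mul_one, sub_zero]
  have hTS : S⁻¹ * S = 1 := Matrix.nonsing_inv_mul _ hu
  have hST : S * S⁻¹ = 1 := Matrix.mul_nonsing_inv _ hu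
  have hCT : chainC q * S⁻¹ = chainC q := by
    rw [← hCS, Matrix.mul_assoc, hST, Matrix.mul_one, hCS]
  refine ⟨F1 * S⁻¹, S⁻¹, H, ⟨?_, hCT, ?_, ?_⟩, ?_⟩
  · simp [Matrix.det_nonsing_inv, hdet]
  · rw [← hSB, ← Matrix.mul_assoc, hTS, Matrix.one_mul, hSB]
  · have h1 : S * (chainA q + chainB q * F) = chainA q * S + chainB q * F1 + H * chainC q := by
      rw [Matrix.mul_add, ← Matrix.mul_assoc, hSB, add_assoc, ← key, hS, Matrix.sub_mul,
        Matrix.mul_sub, Matrix.one_mul, Matrix.mul_one]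
      abel
    calc (chainA q + chainB q * F) * S⁻¹
        = S⁻¹ * (S * (chainA q + chainB q * F)) * S⁻¹ := by
          rw [← Matrix.mul_assoc, hTS, Matrix.one_mul]
      _ = S⁻¹ * (chainA q + chainB q * (F1 * S⁻¹) + H * chainC q) := by
          rw [h1, Matrix.mul_assoc, Matrix.add_mul, Matrix.add_mul, Matrix.mul_assoc _ S, hST,
            Matrix.mul_one, Matrix.mul_assoc, Matrix.mul_assoc, hCT]
  · intro i j k hij hk
    -- In this form it is visible that right multiplication by `S⁻¹` leaves the columns of
    -- components `≥ K` unchanged.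
    have hT : S⁻¹ = 1 + S⁻¹ * M := by
      have : M = 1 - S := by rw [hS]; abel
      rw [this, Matrix.mul_sub, hTS, Matrix.mul_one]
      abel
    have hz : (F1 * (S⁻¹ * M)) i ⟨j, k⟩ = 0 := by
      rw [← Matrix.mul_assoc, Matrix.mul_apply]
      refine Finset.sum_eq_zero fun d _ => ?_
      rw [hM, chainShift_eq_zero F K d ⟨j, k⟩ hk, mul_zero]
    rw [hT, Matrix.mul_add, Matrix.mul_one, Matrix.add_apply, hz, add_zero]
    simp only [hF1, of_apply]
    split_ifs with h
    · rfl
    · exact hF i j k hij (Nat.lt_of_le_of_ne hk fun e => h ⟨hij, e.symm⟩)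

lemma exists_chainEquiv_isStrictlyBlockLower_of_vanishesFrom (hq0 : ∀ i, 0 < q i)
    (hq : Antitone q) (K : ℕ) (F : Matrix (Fin N) (ChainIdx q) ℝ) (hF : VanishesFrom F (K + 1)) :
    ∃ F' T H, ChainEquiv F F' T H ∧ IsStrictlyBlockLower F' := by
  induction K generalizing F with
  | zero =>
    -- Only the columns of first components still violate the structure. They have the form of a
    -- matrix times `chainC q`, so they move into the output injection without a change of
    -- coordinates.
    refine ⟨Matrix.of fun i d => if (d.2 : ℕ) = 0 then 0 else F i d, 1,
      chainB q * Matrix.of fun i j => F i ⟨j, ⟨0, hq0 j⟩⟩, ⟨by simp, by simp, by simp, ?_⟩, ?_⟩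
    · rw [Matrix.mul_one, Matrix.one_mul, add_assoc, Matrix.mul_assoc, ← Matrix.mul_add]
      congr 2
      ext i ⟨j, k⟩
      rw [Matrix.add_apply, mul_chainC_apply]
      by_cases hk : (k : ℕ) = 0
      · have : k = ⟨0, hq0 j⟩ := Fin.ext hk
        simp [this]
      · simp [hk]
    · rintro i j k h
      by_cases hk : (k : ℕ) = 0
      · simp [hk]
      · simp only [of_apply, if_neg hk]
        exact hF i j k (h.resolve_right hk) (by omega)
  | succ K ih =>
    obtain ⟨F1, T1, H1, h1, hF1⟩ := exists_chainEquiv_vanishesFrom hq0 hq F (K + 1) hF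
    obtain ⟨F2, T2, H2, h2, hF2⟩ := ih F1 hF1
    exact ⟨F2, _, _, h1.trans h2, hF2⟩

theorem exists_chainEquiv_isStrictlyBlockLower (hq0 : ∀ i, 0 < q i) (hq : Antitone q)
    (F : Matrix (Fin N) (ChainIdx q) ℝ) :
    ∃ F' T H, ChainEquiv F F' T H ∧ IsStrictlyBlockLower F' := by
  -- The sum of the lengths exceeds every component number, so the vanishing hypothesis is empty.
  refine exists_chainEquiv_isStrictlyBlockLower_of_vanishesFrom hq0 hq (∑ i, q i) F ?_
  intro i j k _ hk
  have h1 := Finset.single_le_sum (f := q) (fun _ _ => Nat.zero_le _) (Finset.mem_univ j)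
  have h2 := k.2
  omega

lemma IsStrictlyBlockLower.isBlockLower {F : Matrix (Fin N) (ChainIdx q) ℝ}
    (hF : IsStrictlyBlockLower F) : IsBlockLower (chainA q + chainB q * F) := by
  rintro ⟨i, r⟩ ⟨j, k⟩ h
  have hij : i < j := h
  rw [Matrix.add_apply, chainA_apply, chainB_mul_apply, if_neg (fun h => hij.ne h.1),
    hF i j k (Or.inl hij.le), ite_self, add_zero]

end ChainMatrices

/-! ### Normalising a system that is already in SCB form -/

lemma IsNonsingular.one {α : Type*} [Fintype α] [DecidableEq α] :
    IsNonsingular (1 : Matrix α α ℝ) := ⟨1, by simp, by simp⟩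

lemma subsystemDTransformation_mul (na nc : ℕ) {pb md : ℕ} (l : Fin pb → ℕ) {q : Fin md → ℕ}
    (T T' : Matrix (ChainIdx q) (ChainIdx q) ℝ) :
    subsystemDTransformation na nc l T * subsystemDTransformation na nc l T' =
      subsystemDTransformation na nc l (T * T') := by
  simp [subsystemDTransformation, fromBlocks_multiply]

lemma subsystemDTransformation_one (na nc : ℕ) {pb md : ℕ} (l : Fin pb → ℕ) {q : Fin md → ℕ} :
    subsystemDTransformation na nc l (1 : Matrix (ChainIdx q) (ChainIdx q) ℝ) = 1 := by
  simp [subsystemDTransformation, fromBlocks_one]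

lemma subsystemDTransformation_mul_fromRows (na nc : ℕ) {pb md : ℕ} (l : Fin pb → ℕ)
    {q : Fin md → ℕ} (T : Matrix (ChainIdx q) (ChainIdx q) ℝ) {α : Type*}
    (Ma : Matrix (Fin na) α ℝ) (Mb : Matrix (ChainIdx l) α ℝ) (Mc : Matrix (Fin nc) α ℝ)
    (Md : Matrix (ChainIdx q) α ℝ) :
    subsystemDTransformation na nc l T * fromRows Ma (fromRows Mb (fromRows Mc Md)) =
      fromRows Ma (fromRows Mb (fromRows Mc (T * Md))) := by
  simp [subsystemDTransformation, fromBlocks_mul_fromRows]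

lemma fromCols_mul_subsystemDTransformation (na nc : ℕ) {pb md : ℕ} (l : Fin pb → ℕ)
    {q : Fin md → ℕ} (T : Matrix (ChainIdx q) (ChainIdx q) ℝ) {α : Type*}
    (Ma : Matrix α (Fin na) ℝ) (Mb : Matrix α (ChainIdx l) ℝ) (Mc : Matrix α (Fin nc) ℝ)
    (Md : Matrix α (ChainIdx q) ℝ) :
    fromCols Ma (fromCols Mb (fromCols Mc Md)) * subsystemDTransformation na nc l T =
      fromCols Ma (fromCols Mb (fromCols Mc (Md * T))) := by
  simp [subsystemDTransformation, fromCols_mul_fromBlocks]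

namespace SCBData

variable {m₀ na nc mc pb md : ℕ} {l : Fin pb → ℕ} {q : Fin md → ℕ}

/-- Subsystem (d) is coupled to the others, apart from `B0 * C0`, only through `chainB q` on the
left and `chainC q` on the right. `Td` fixes both, so these couplings survive unchanged. -/
theorem exists_isStrictlyBlockLower (Φ : SCBData m₀ na nc mc l q)
    (hq0 : ∀ i, 0 < q i) (hq : Antitone q) :
    ∃ (Td : Matrix (ChainIdx q) (ChainIdx q) ℝ)
        (Fdd' : Matrix (Fin md) (ChainIdx q) ℝ) (Hdd' : Matrix (ChainIdx q) (Fin md) ℝ)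
        (Φ' : SCBData m₀ na nc mc l q),
        IsUnit Td.det ∧
        chainC q * Td = chainC q ∧
        Td⁻¹ * chainB q = chainB q ∧
        Φ' = { Φ with
          Fdd := Fdd'
          Hdd := Hdd'
          B0d := Td⁻¹ * Φ.B0d
          C0d := Φ.C0d * Td } ∧
        Φ.toSystem.TransformsTo (subsystemDTransformation na nc l Td) 1 1 Φ'.toSystem ∧
        IsStrictlyBlockLower Φ'.Fdd ∧
        IsBlockLower (Φ'.Ad - Φ'.Hdd * chainC q) := by
  obtain ⟨F', T, H, h, hF'⟩ := exists_chainEquiv_isStrictlyBlockLower hq0 hq Φ.Fdd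
  have hTT : T * T⁻¹ = 1 := Matrix.mul_nonsing_inv _ h.isUnit_det
  have hTT' : T⁻¹ * T = 1 := Matrix.nonsing_inv_mul _ h.isUnit_det
  have hAd : Φ.Ad * T = T * (chainA q + chainB q * F' + (H + T⁻¹ * Φ.Hdd) * chainC q) := by
    rw [Ad, Matrix.add_mul, h.conj, Matrix.mul_assoc, h.chainC_mul, Matrix.add_mul H, ← add_assoc,
      Matrix.mul_add T (_ + _ + _), Matrix.mul_assoc T⁻¹, ← Matrix.mul_assoc T T⁻¹, hTT,
      Matrix.one_mul]
  refine ⟨T, F', H + T⁻¹ * Φ.Hdd, _, h.isUnit_det, h.chainC_mul, ?_, rfl, ?_, hF', ?_⟩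
  · rw [← h.mul_chainB, ← Matrix.mul_assoc, hTT', Matrix.one_mul, h.mul_chainB]
  · have hT0 : T * (T⁻¹ * Φ.B0d) = Φ.B0d := by rw [← Matrix.mul_assoc, hTT, Matrix.one_mul]
    refine ⟨⟨subsystemDTransformation na nc l T⁻¹, ?_, ?_⟩, IsNonsingular.one, IsNonsingular.one,
      ?_, ?_, ?_, ?_⟩
    · rw [subsystemDTransformation_mul, hTT, subsystemDTransformation_one]
    · rw [subsystemDTransformation_mul, hTT', subsystemDTransformation_one]
    · have hA0 : Φ.B0 * Φ.C0 * subsystemDTransformation na nc l T =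
          subsystemDTransformation na nc l T * (fromRows Φ.B0a (fromRows Φ.B0b (fromRows Φ.B0c
            (T⁻¹ * Φ.B0d))) * fromCols Φ.C0a (fromCols Φ.C0b (fromCols Φ.C0c (Φ.C0d * T)))) := by
        rw [Matrix.mul_assoc, ← Matrix.mul_assoc (subsystemDTransformation na nc l T),
          subsystemDTransformation_mul_fromRows, hT0, B0, C0, fromCols_mul_subsystemDTransformation]
      simp only [toSystem, Matrix.add_mul, Matrix.mul_add]
      refine congrArg₂ _ ?_ hA0
      simp only [subsystemDTransformation_mul_fromRows, fromCols_mul_subsystemDTransformation,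
        fromRows_mul, mul_fromCols, ← Matrix.mul_assoc, h.mul_chainB, hAd]
      simp only [Matrix.mul_assoc, h.chainC_mul, Ab, Ad]
    · simp only [toSystem, Matrix.mul_one, subsystemDTransformation_mul_fromRows, mul_fromCols, hT0,
        h.mul_chainB, Matrix.mul_zero]
    · simp only [toSystem, Matrix.one_mul, fromRows_mul, fromCols_mul_subsystemDTransformation,
        h.chainC_mul, Matrix.zero_mul]
    · simp [toSystem]
  · simp only [Ad]
    rw [add_sub_cancel_right]
    exact hF'.isBlockLower

end SCBData

/-! ### Decomposition of the covectors into integrator chains -/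

section ChainDecomposition

open Module Submodule

variable {𝕜 V : Type*} [Field 𝕜] [AddCommGroup V] [Module 𝕜 V]

/-- The span of the first components of a family of chains. -/
abbrev spanHeads (𝕜 : Type*) {V ι : Type*} [Field 𝕜] [AddCommGroup V] [Module 𝕜 V]
    (x : ι → ℕ → V) : Submodule 𝕜 V :=
  span 𝕜 (Set.range fun i => x i 0)

/-- The span of the components of a family of chains of lengths `q`. -/
abbrev spanChains (𝕜 : Type*) {V ι : Type*} [Field 𝕜] [AddCommGroup V] [Module 𝕜 V]
    (q : ι → ℕ) (x : ι → ℕ → V) : Submodule 𝕜 V :=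
  span 𝕜 (Set.range fun c : Σ i, Fin (q i) => x c.1 c.2)

lemma mem_spanChains {ι : Type*} {q : ι → ℕ} (x : ι → ℕ → V) (i : ι) {k : ℕ} (hk : k < q i) :
    x i k ∈ spanChains 𝕜 q x :=
  subset_span ⟨⟨i, ⟨k, hk⟩⟩, rfl⟩

lemma spanHeads_le_spanChains {ι : Type*} {q : ι → ℕ} (hq : ∀ i, 0 < q i) (x : ι → ℕ → V) :
    spanHeads 𝕜 x ≤ spanChains 𝕜 q x := by
  rw [span_le]
  rintro _ ⟨i, rfl⟩
  exact mem_spanChains x i (hq i)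

/-- Covectors of a linear system that decompose it into integrator chains. Here `V` is the space of
state covectors, `a` maps a covector to its derivative along the autonomous dynamics, `N` consists
of the covectors whose derivative is not affected by the input, and `Y` of the output covectors.
The chains `xb` end without input, the chains `xd` end with independent inputs, and the remaining
coordinates are `xc`; all relations hold up to output injection. -/
structure ChainDecomposition (a : V →ₗ[𝕜] V) (N Y : Submodule 𝕜 V) {ιb ιc ιd : Type*}
    [Fintype ιb] [Fintype ιc] [Fintype ιd] (l : ιb → ℕ) (q : ιd → ℕ)
    (xb : ιb → ℕ → V) (xc : ιc → V) (xd : ιd → ℕ → V) : Prop where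
  l_pos : ∀ i, 0 < l i
  q_pos : ∀ i, 0 < q i
  xb_eq_zero : ∀ i k, l i ≤ k → xb i k = 0
  spanHeads_sup : spanHeads 𝕜 xb ⊔ spanHeads 𝕜 xd = Y
  xb_mem : ∀ i k, xb i k ∈ N
  xd_mem : ∀ i k, k + 1 < q i → xd i k ∈ N
  map_xb : ∀ i k, a (xb i k) - xb i (k + 1) ∈ Y
  map_xd : ∀ i k, k + 1 < q i → a (xd i k) - xd i (k + 1) ∈ Y
  map_xc : ∀ i, a (xc i) ∈ span 𝕜 (Set.range xc) ⊔ Y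
  indep : ∀ (α : ιd → 𝕜), ∀ ξ ∈ span 𝕜 (Set.range xc),
    ∑ i, α i • xd i (q i - 1) + ξ ∈ N → α = 0
  span_eq_top : spanChains 𝕜 l xb ⊔ span 𝕜 (Set.range xc) ⊔ spanChains 𝕜 q xd = ⊤
  card_le : ∑ i, l i + Fintype.card ιc + ∑ i, q i ≤ finrank 𝕜 V
  card_heads_le : Fintype.card ιb + Fintype.card ιd ≤ finrank 𝕜 Y

/-- Put a vector in front of every chain. -/
def prolong {ι V : Type*} (y : ι → V) (x : ι → ℕ → V) : ι → ℕ → V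
  | i, 0 => y i
  | i, k + 1 => x i k

lemma prolong_of_pos {ι V : Type*} (y : ι → V) (x : ι → ℕ → V) (i : ι) (k : ℕ) (hk : 0 < k) :
    prolong y x i k = x i (k - 1) := by
  obtain ⟨k, rfl⟩ := Nat.exists_eq_succ_of_ne_zero hk.ne'
  rfl

/-- The recursion step. Heads of the reduced chains span `LinearMap.range g`, so each is, modulo
`Y`, the derivative of some element of `Y ⊓ N`, which becomes the new head. The kernel of `g` gives
new chains (b) of length one, and a complement of `Y ⊓ N` in `Y` gives new chains (d) of length one.
Relations modulo `range g` become relations modulo `Y` after subtracting elements of `Y ⊓ N`. -/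
theorem ChainDecomposition.prolong [FiniteDimensional 𝕜 V] {a : V →ₗ[𝕜] V} {N Y Z : Submodule 𝕜 V}
    (hZ : IsCompl Z Y) (hN : ∀ y ∈ Y, ∀ z ∈ Z, y + z ∈ N → y ∈ N)
    {g : ↥(Y ⊓ N) →ₗ[𝕜] Z} (hg : g = Z.projectionOnto Y hZ ∘ₗ a ∘ₗ (Y ⊓ N).subtype)
    {ιb ιc ιd : Type} [Fintype ιb] [Fintype ιc] [Fintype ιd] {l : ιb → ℕ} {q : ιd → ℕ}
    {xb : ιb → ℕ → Z} {xc : ιc → Z} {xd : ιd → ℕ → Z}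
    (D : ChainDecomposition (Z.projectionOnto Y hZ ∘ₗ a ∘ₗ Z.subtype) (N.comap Z.subtype)
      (LinearMap.range g) l q xb xc xd) :
    ∃ (ιb ιc ιd : Type) (_ : Fintype ιb) (_ : Fintype ιc) (_ : Fintype ιd) (l : ιb → ℕ)
      (q : ιd → ℕ) (xb : ιb → ℕ → V) (xc : ιc → V) (xd : ιd → ℕ → V),
      ChainDecomposition a N Y l q xb xc xd := by
  set p := Z.projectionOnto Y hZ with hp
  have pY : ∀ v, p v = 0 ↔ v ∈ Y := fun v => projectionOnto_apply_eq_zero_iff hZ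
  have pZ : ∀ z : Z, p z = z := fun z => projectionOnto_apply_left hZ z
  have g_apply : ∀ y, g y = p (a y) := fun y => by rw [hg]; rfl
  -- a generalized inverse of `g`
  obtain ⟨r, hr⟩ : ∃ r : Z →ₗ[𝕜] ↥(Y ⊓ N), ∀ z ∈ LinearMap.range g, g (r z) = z := by
    obtain ⟨s, hs⟩ := g.rangeRestrict.exists_rightInverse_of_surjective g.range_rangeRestrict
    obtain ⟨r, hr⟩ := LinearMap.exists_extend s
    refine ⟨r, fun z hz => ?_⟩
    have h1 : r z = s ⟨z, hz⟩ := LinearMap.congr_fun hr ⟨z, hz⟩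
    have h2 := LinearMap.congr_fun hs ⟨z, hz⟩
    rw [h1]
    exact congrArg Subtype.val h2
  have rY : ∀ z, (r z : V) ∈ Y := fun z => (r z).2.1
  have rN : ∀ z, (r z : V) ∈ N := fun z => (r z).2.2
  -- a complement of `Y ⊓ N` in `Y`
  obtain ⟨C, hC⟩ := Submodule.exists_isCompl (Y ⊓ N)
  set Y1 := C ⊓ Y with hY1
  have hY1sup : Y ⊓ N ⊔ Y1 = Y := by
    rw [hY1, ← sup_inf_assoc_of_le C (inf_le_left : Y ⊓ N ≤ Y), hC.sup_eq_top, top_inf_eq]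
  have hY1inf : Y ⊓ N ⊓ Y1 = ⊥ := by
    rw [eq_bot_iff, ← hC.inf_eq_bot]
    exact inf_le_inf_left _ inf_le_left
  let b1 := finBasis 𝕜 Y1
  let b4 := finBasis 𝕜 (LinearMap.ker g)
  -- the corrected lifts of the elements of `Z`
  let f : Z → Z → V := fun x x' => x - r (p (a x) - x')
  have f_map : ∀ x x' : Z, p (a x) - x' ∈ LinearMap.range g → a (f x x') - x' ∈ Y := by
    intro x x' h
    rw [← pY, map_sub, map_sub, map_sub, ← g_apply, hr _ h, pZ]
    abel
  have f_N : ∀ x x' : Z, (x : V) ∈ N → f x x' ∈ N := fun x x' h => sub_mem h (rN _)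
  have f_Y : ∀ x x' : Z, (x : V) - f x x' ∈ Y := fun x x' => by simp only [f, sub_sub_cancel, rY]
  have f_Y' : ∀ (v : V) (x : Z), v - x ∈ Y → ∀ x', v - f x x' ∈ Y := by
    intro v x h x'
    have := add_mem h (f_Y x x')
    rwa [sub_add_sub_cancel] at this
  have r_map : ∀ z ∈ LinearMap.range g, a (r z) - z ∈ Y := by
    intro z h
    rw [← pY, map_sub, ← g_apply, hr _ h, pZ, sub_self]
  -- the new coordinates
  have hxc : ∀ i, ∃ h : ↥(Y ⊓ N), p (a (xc i)) - g h ∈ span 𝕜 (Set.range xc) := by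
    intro i
    obtain ⟨u, hu, w, ⟨h, rfl⟩, e⟩ := mem_sup.1 (D.map_xc i)
    refine ⟨h, ?_⟩
    have e' : p (a (xc i)) = u + g h := e.symm
    rwa [e', add_sub_cancel_right]
  choose hc hhc using hxc
  let xb' : ιb ⊕ Fin (finrank 𝕜 (LinearMap.ker g)) → ℕ → V := Sum.elim
    (_root_.prolong (fun i => (r (xb i 0) : V)) fun i k => f (xb i k) (xb i (k + 1)))
    (_root_.prolong (fun j => ((b4 j : ↥(Y ⊓ N)) : V)) fun _ _ => 0)
  let xd' : ιd ⊕ Fin (finrank 𝕜 Y1) → ℕ → V := Sum.elim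
    (_root_.prolong (fun i => (r (xd i 0) : V)) fun i k => f (xd i k) (xd i (k + 1)))
    (_root_.prolong (fun j => (b1 j : V)) fun _ _ => 0)
  let xc' : ιc → V := fun i => xc i - hc i
  let l' : ιb ⊕ Fin (finrank 𝕜 (LinearMap.ker g)) → ℕ := Sum.elim (fun i => l i + 1) fun _ => 1
  let q' : ιd ⊕ Fin (finrank 𝕜 Y1) → ℕ := Sum.elim (fun i => q i + 1) fun _ => 1
  have hl' : ∀ i, 0 < l' i := by rintro (i | i) <;> simp [l']
  have hq' : ∀ i, 0 < q' i := by rintro (i | i) <;> simp [q']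
  have hheads : spanHeads 𝕜 xb' ⊔ spanHeads 𝕜 xd' = Y := by
    refine le_antisymm (sup_le (span_le.2 ?_) (span_le.2 ?_)) ?_
    · rintro _ ⟨i | i, rfl⟩
      · exact rY _
      · exact (b4 i : ↥(Y ⊓ N)).2.1
    · rintro _ ⟨i | i, rfl⟩
      · exact rY _
      · exact (b1 i).2.2
    · set T := spanHeads 𝕜 xb' ⊔ spanHeads 𝕜 xd' with hT
      have h1 : Y1 ≤ T := by
        rw [← map_subtype_top Y1, ← b1.span_eq, map_span, span_le]
        rintro _ ⟨_, ⟨j, rfl⟩, rfl⟩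
        exact mem_sup_right (subset_span ⟨Sum.inr j, rfl⟩)
      have h2 : LinearMap.ker g ≤ T.comap (Y ⊓ N).subtype := by
        rw [← map_subtype_top (LinearMap.ker g), ← b4.span_eq, map_span, span_le]
        rintro _ ⟨_, ⟨j, rfl⟩, rfl⟩
        exact mem_sup_left (subset_span ⟨Sum.inr j, rfl⟩)
      have h3 : LinearMap.range g ≤ T.comap ((Y ⊓ N).subtype ∘ₗ r) := by
        rw [← D.spanHeads_sup]
        refine sup_le (span_le.2 ?_) (span_le.2 ?_)
        · rintro _ ⟨i, rfl⟩
          exact mem_sup_left (subset_span ⟨Sum.inl i, rfl⟩)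
        · rintro _ ⟨i, rfl⟩
          exact mem_sup_right (subset_span ⟨Sum.inl i, rfl⟩)
      have h4 : Y ⊓ N ≤ T := by
        intro y hy
        have h5 : (r (g ⟨y, hy⟩) : V) ∈ T := h3 ⟨_, rfl⟩
        have h6 : (⟨y, hy⟩ - r (g ⟨y, hy⟩) : ↥(Y ⊓ N)) ∈ LinearMap.ker g := by
          rw [LinearMap.mem_ker, map_sub, hr _ ⟨_, rfl⟩, sub_self]
        have h7 : y - r (g ⟨y, hy⟩) ∈ T := h2 h6
        simpa using add_mem h7 h5
      calc Y = Y ⊓ N ⊔ Y1 := hY1sup.symm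
        _ ≤ T := sup_le h4 h1
  have hbY : spanHeads 𝕜 xb ≤ LinearMap.range g := D.spanHeads_sup ▸ le_sup_left
  have hdY : spanHeads 𝕜 xd ≤ LinearMap.range g := D.spanHeads_sup ▸ le_sup_right
  have hspanc : ∀ z ∈ span 𝕜 (Set.range xc), (z : V) ∈ span 𝕜 (Set.range xc') ⊔ Y := by
    suffices h : span 𝕜 (Set.range xc) ≤ (span 𝕜 (Set.range xc') ⊔ Y).comap Z.subtype from h
    rw [span_le]
    rintro _ ⟨i, rfl⟩
    have h := add_mem_sup (subset_span ⟨i, rfl⟩ : xc' i ∈ span 𝕜 (Set.range xc')) (hc i).2.1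
    rwa [sub_add_cancel] at h
  refine ⟨_, ιc, _, inferInstance, inferInstance, inferInstance, l', q', xb', xc', xd',
    hl', hq', ?_, hheads, ?_, ?_, ?_, ?_, ?_, ?_, ?_, ?_, ?_⟩
  · rintro (i | i) k hk
    · have hk' : l i + 1 ≤ k := hk
      change _root_.prolong _ _ i k = 0
      rw [prolong_of_pos _ _ _ _ (by omega), D.xb_eq_zero i (k - 1) (by omega),
        D.xb_eq_zero i (k - 1 + 1) (by omega)]
      simp [f]
    · exact prolong_of_pos _ _ _ _ hk
  · rintro (i | i) (_ | k)
    · exact rN _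
    · exact f_N _ _ (D.xb_mem i k)
    · exact (b4 i : ↥(Y ⊓ N)).2.2
    · exact zero_mem _
  · rintro (i | i) k hk
    · rcases k with _ | k
      · exact rN _
      · exact f_N _ _ (D.xd_mem i k (Nat.lt_of_succ_lt_succ hk))
    · have : k + 1 < 1 := hk
      omega
  · rintro (i | i) (_ | k)
    · exact f_Y' _ _ (r_map _ (hbY (subset_span ⟨i, rfl⟩))) _
    · exact f_Y' _ _ (f_map _ _ (D.map_xb i k)) _
    · have h : g (b4 i) = 0 := (b4 i).2
      rw [g_apply, pY] at h
      change a ((b4 i : ↥(Y ⊓ N)) : V) - 0 ∈ Y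
      rwa [sub_zero]
    · simp [xb', _root_.prolong]
  · rintro (i | i) k hk
    · rcases k with _ | k
      · exact f_Y' _ _ (r_map _ (hdY (subset_span ⟨i, rfl⟩))) _
      · exact f_Y' _ _ (f_map _ _ (D.map_xd i k (Nat.lt_of_succ_lt_succ hk))) _
    · have : k + 1 < 1 := hk
      omega
  · intro i
    have h : a (xc' i) - (p (a (xc i)) - g (hc i) : Z) ∈ Y := by
      rw [← pY, map_sub, pZ, map_sub, map_sub, g_apply, sub_self]
    have h' := add_mem (mem_sup_right h) (hspanc _ (hhc i))
    rwa [sub_add_cancel] at h'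
  · intro α ξ hξ h
    -- All corrections lie in `N`, so the condition reduces to `y + z ∈ N`, with `y` from the new
    -- chains of length one and `z` from the reduced system; `hN` separates the two.
    have hle : span 𝕜 (Set.range xc') ≤ (span 𝕜 (Set.range xc)).map Z.subtype ⊔ Y ⊓ N := by
      rw [span_le]
      rintro _ ⟨i, rfl⟩
      exact sub_mem (mem_sup_left ⟨_, subset_span ⟨i, rfl⟩, rfl⟩) (mem_sup_right (hc i).2)
    obtain ⟨_, ⟨ζ, hζ, rfl⟩, u, hu, rfl⟩ := mem_sup.1 (hle hξ)
    rw [Fintype.sum_sum_type] at h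
    set z : Z := ∑ i, α (Sum.inl i) • xd i (q i - 1) + ζ with hz
    set y : Y1 := ∑ j, α (Sum.inr j) • b1 j with hy
    have e1 : ∀ i, xd' (Sum.inl i) (q' (Sum.inl i) - 1) =
        xd i (q i - 1) - r (p (a (xd i (q i - 1))) - xd i (q i - 1 + 1)) := fun i =>
      prolong_of_pos _ _ _ _ (D.q_pos i)
    have e2 : ∑ i, α (Sum.inl i) • xd' (Sum.inl i) (q' (Sum.inl i) - 1) +
        ∑ i, α (Sum.inr i) • xd' (Sum.inr i) (q' (Sum.inr i) - 1) + (Z.subtype ζ + u) =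
        y + z + (u - ∑ i, α (Sum.inl i) • (r (p (a (xd i (q i - 1))) - xd i (q i - 1 + 1)) : V)) := by
      simp only [e1, hz, hy, smul_sub, Finset.sum_sub_distrib, coe_add, coe_sum, coe_smul]
      change _ + ∑ i, α (Sum.inr i) • (b1 i : V) + _ = _
      rw [subtype_apply]
      abel
    rw [e2] at h
    have hyz : (y + z : V) ∈ N := by
      refine (add_mem_cancel_right ?_).1 h
      exact sub_mem hu.2 (sum_mem fun i _ => smul_mem _ _ (rN _))
    have hyN : (y : V) ∈ N := hN _ y.2.2 _ z.2 hyz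
    have hy0 : y = 0 := by
      have : (y : V) ∈ Y ⊓ N ⊓ Y1 := ⟨⟨y.2.2, hyN⟩, y.2⟩
      rw [hY1inf, mem_bot] at this
      exact Subtype.ext this
    have hzN : (z : V) ∈ N := by
      rwa [hy0, ZeroMemClass.coe_zero, zero_add] at hyz
    have h1 := D.indep (fun i => α (Sum.inl i)) ζ hζ hzN
    have h2 := Fintype.linearIndependent_iff.1 b1.linearIndependent (fun i => α (Sum.inr i)) hy0
    funext i
    rcases i with i | i
    · exact congrFun h1 i
    · exact h2 i
  · set T := spanChains 𝕜 l' xb' ⊔ span 𝕜 (Set.range xc') ⊔ spanChains 𝕜 q' xd' with hT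
    have hbT : spanChains 𝕜 l' xb' ≤ T := le_sup_left.trans le_sup_left
    have hcT : span 𝕜 (Set.range xc') ≤ T := le_sup_right.trans le_sup_left
    have hdT : spanChains 𝕜 q' xd' ≤ T := le_sup_right
    have hYT : Y ≤ T := by
      rw [← hheads]
      exact sup_le ((spanHeads_le_spanChains hl' _).trans hbT)
        ((spanHeads_le_spanChains hq' _).trans hdT)
    have hfT : ∀ x x' : Z, f x x' ∈ T → (x : V) ∈ T := by
      intro x x' h
      have := add_mem h (hYT (f_Y x x'))
      rwa [add_sub_cancel] at this
    have hZT : ⊤ ≤ T.comap Z.subtype := by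
      rw [← D.span_eq_top]
      refine sup_le (sup_le (span_le.2 ?_) fun z hz => sup_le hcT hYT (hspanc z hz)) (span_le.2 ?_)
      · rintro _ ⟨⟨i, k⟩, rfl⟩
        have h := mem_spanChains (𝕜 := 𝕜) (q := l') xb' (Sum.inl i) (Nat.succ_lt_succ k.2)
        exact hfT _ _ (hbT h)
      · rintro _ ⟨⟨i, k⟩, rfl⟩
        have h := mem_spanChains (𝕜 := 𝕜) (q := q') xd' (Sum.inl i) (Nat.succ_lt_succ k.2)
        exact hfT _ _ (hdT h)
    rw [eq_top_iff, ← hZ.sup_eq_top]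
    exact sup_le (fun z hz => hZT (mem_top : (⟨z, hz⟩ : Z) ∈ ⊤)) hYT
  -- Every old chain grows by one, which `card_heads_le` bounds by the rank of `g`; the kernel of
  -- `g` and `Y1` supply the rest of the dimension of `Y`.
  all_goals
    have c1 := D.card_le
    have c2 := D.card_heads_le
    have c3 := LinearMap.finrank_range_add_finrank_ker g
    have c4 := finrank_sup_add_finrank_inf_eq (Y ⊓ N) Y1
    rw [hY1sup, hY1inf, finrank_bot] at c4
    have c5 := finrank_add_eq_of_isCompl hZ
    simp only [l', q', Fintype.sum_sum_type, Sum.elim_inl, Sum.elim_inr, Finset.sum_add_distrib,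
      Finset.sum_const, Finset.card_univ, Fintype.card_sum, Fintype.card_fin, smul_eq_mul, mul_one]
    omega

/-- `Z` is assembled from a complement of `Y ⊓ N` inside `N` and a complement of `N ⊔ Y`, so that
`N` splits along `Z` and `Y`. -/
lemma exists_isCompl_disjoint (N Y : Submodule 𝕜 V) :
    ∃ Z, IsCompl Z Y ∧ ∀ y ∈ Y, ∀ z ∈ Z, y + z ∈ N → y ∈ N := by
  obtain ⟨C, hC⟩ := Submodule.exists_isCompl (Y ⊓ N)
  obtain ⟨Z2, hZ2⟩ := Submodule.exists_isCompl (N ⊔ Y)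
  have h1 : Y ⊔ C ⊓ N = N ⊔ Y := by
    have h2 : Y ⊓ N ⊔ C ⊓ N = N := by
      rw [← sup_inf_assoc_of_le C (inf_le_right : Y ⊓ N ≤ N), hC.sup_eq_top, top_inf_eq]
    calc Y ⊔ C ⊓ N = Y ⊔ (Y ⊓ N ⊔ C ⊓ N) := by rw [← sup_assoc, sup_inf_self]
      _ = N ⊔ Y := by rw [h2, sup_comm]
  have key : ∀ y ∈ Y, ∀ z ∈ C ⊓ N ⊔ Z2, y + z ∈ N → y ∈ N ∧ z ∈ C ⊓ N := by
    intro y hy z hz h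
    obtain ⟨z1, hz1, z2, hz2, rfl⟩ := mem_sup.1 hz
    have h2 : z2 ∈ N ⊔ Y := by
      have : z2 = (y + (z1 + z2)) - z1 - y := by abel
      rw [this]
      exact sub_mem (mem_sup_left (sub_mem h hz1.2)) (mem_sup_right hy)
    have h3 : z2 = 0 := (disjoint_def.1 hZ2.disjoint) z2 h2 hz2
    subst h3
    rw [add_zero] at h ⊢
    exact ⟨(add_mem_cancel_right hz1.2).1 h, hz1⟩
  refine ⟨C ⊓ N ⊔ Z2, ⟨?_, ?_⟩, fun y hy z hz h => (key y hy z hz h).1⟩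
  · rw [disjoint_def]
    intro z hz hzY
    have h := key (-z) (neg_mem hzY) z hz (by simp)
    exact disjoint_def.1 hC.disjoint z ⟨hzY, h.2.2⟩ h.2.1
  · rw [codisjoint_iff, sup_comm, ← sup_assoc, h1, hZ2.sup_eq_top]

theorem exists_chainDecomposition (n : ℕ) :
    ∀ (V : Type) [AddCommGroup V] [Module 𝕜 V] [FiniteDimensional 𝕜 V], finrank 𝕜 V ≤ n →
      ∀ (a : V →ₗ[𝕜] V) (N Y : Submodule 𝕜 V),
      ∃ (ιb ιc ιd : Type) (_ : Fintype ιb) (_ : Fintype ιc) (_ : Fintype ιd) (l : ιb → ℕ)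
        (q : ιd → ℕ) (xb : ιb → ℕ → V) (xc : ιc → V) (xd : ιd → ℕ → V),
        ChainDecomposition a N Y l q xb xc xd := by
  induction n with
  | zero =>
    intro V _ _ _ hV a N Y
    have := finrank_zero_iff.1 (Nat.le_zero.1 hV)
    refine ⟨Empty, Empty, Empty, inferInstance, inferInstance, inferInstance, Empty.elim,
      Empty.elim, Empty.elim, Empty.elim, Empty.elim, ?_⟩
    constructor <;> simp [Subsingleton.elim _ (⊥ : Submodule 𝕜 V), eq_iff_true_of_subsingleton]
  | succ n ih =>
    intro V _ _ _ hV a N Y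
    -- Without outputs all of `V` goes into `xc`; otherwise the complement `Z` has smaller
    -- dimension.
    by_cases hY : Y = ⊥
    · let b := finBasis 𝕜 V
      refine ⟨Empty, _, Empty, inferInstance, inferInstance, inferInstance, Empty.elim,
        Empty.elim, Empty.elim, b, Empty.elim, ?_⟩
      constructor <;> simp [b.span_eq, hY, eq_iff_true_of_subsingleton]
    · obtain ⟨Z, hZ, hN⟩ := exists_isCompl_disjoint N Y
      have h1 := finrank_add_eq_of_isCompl hZ
      have h2 := one_le_finrank_iff.2 hY
      obtain ⟨ιb, ιc, ιd, _, _, _, l, q, xb, xc, xd, D⟩ := ih Z (by omega)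
        (Z.projectionOnto Y hZ ∘ₗ a ∘ₗ Z.subtype) (N.comap Z.subtype)
        (LinearMap.range (Z.projectionOnto Y hZ ∘ₗ a ∘ₗ (Y ⊓ N).subtype))
      exact D.prolong hZ hN rfl

end ChainDecomposition

/-! ### Separating the subsystems (a) and (c), and correcting the chains (d) -/

section SCBCovectors

open Module Submodule

variable {𝕜 V : Type*} [Field 𝕜] [AddCommGroup V] [Module 𝕜 V]

/-- Split off from `E` an `f`-invariant part of `K` such that `f` maps the rest of `K` into a
complement. -/
theorem exists_invariant_splitting [FiniteDimensional 𝕜 V] (f : V →ₗ[𝕜] V) (n : ℕ) :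
    ∀ E K : Submodule 𝕜 V, finrank 𝕜 E ≤ n → K ≤ E → K.map f ≤ E →
      ∃ Ea Ec : Submodule 𝕜 V, Ea ⊔ Ec = E ∧ Ea ⊓ Ec = ⊥ ∧ Ea ≤ K ∧ Ea.map f ≤ Ea ∧
        (Ec ⊓ K).map f ≤ Ec := by
  induction n with
  | zero =>
    intro E K hE hKE _
    have hE0 : E = ⊥ := finrank_eq_zero.1 (Nat.le_zero.1 hE)
    have hK0 : K = ⊥ := eq_bot_iff.2 (hE0 ▸ hKE)
    exact ⟨⊥, ⊥, by simp [hE0], by simp, by simp, by simp, by simp⟩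
  | succ n ih =>
    intro E K hE hKE hf
    rcases hKE.eq_or_lt with rfl | hlt
    · exact ⟨K, ⊥, by simp, by simp, le_rfl, hf, by simp⟩
    -- Recurse on `K` and its part that `f` keeps in `K`. The piece `Kc` obtained there is enlarged
    -- by its image and then by a complement; neither enlargement meets `K` outside `Kc`.
    have hrank := finrank_lt_finrank_of_lt hlt
    obtain ⟨Ea, Kc, hsup, hinf, hEa, hfEa, hKc⟩ := ih K (K ⊓ K.comap f) (by omega) inf_le_left
      (map_le_iff_le_comap.2 inf_le_right)
    have hKcK : Kc ≤ K := hsup ▸ le_sup_right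
    set L := Kc ⊔ Kc.map f with hL
    have hLE : L ≤ E := sup_le (hKcK.trans hKE) ((map_mono hKcK).trans hf)
    have hLK : ∀ x ∈ L, x ∈ K → x ∈ Kc := by
      intro x hx hxK
      obtain ⟨k, hk, _, ⟨k', hk', rfl⟩, rfl⟩ := mem_sup.1 hx
      have h1 : f k' ∈ K := (add_mem_cancel_left (hKcK hk)).1 hxK
      exact add_mem hk (hKc ⟨k', ⟨hk', hKcK hk', h1⟩, rfl⟩)
    obtain ⟨C, hC⟩ := Submodule.exists_isCompl (K ⊔ L)
    have hKLE : K ⊔ L ≤ E := sup_le hKE hLE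
    have hEcK : ∀ x ∈ L ⊔ C ⊓ E, x ∈ K → x ∈ Kc := by
      intro x hx hxK
      obtain ⟨y, hy, c, hc, rfl⟩ := mem_sup.1 hx
      have h1 : c ∈ K ⊔ L := by
        have := sub_mem (mem_sup_left hxK : y + c ∈ K ⊔ L) (mem_sup_right hy)
        rwa [add_sub_cancel_left] at this
      have h2 : c = 0 := disjoint_def.1 hC.disjoint c h1 hc.1
      subst h2
      rw [add_zero] at hxK ⊢
      exact hLK y hy hxK
    refine ⟨Ea, L ⊔ C ⊓ E, ?_, ?_, hEa.trans inf_le_left, hfEa, ?_⟩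
    · have h1 : K ⊔ L ⊔ C ⊓ E = E := by
        rw [← sup_inf_assoc_of_le C hKLE, hC.sup_eq_top, top_inf_eq]
      have h2 : Ea ⊔ L = K ⊔ L := by
        rw [← hsup, sup_assoc, hL, ← sup_assoc Kc Kc, sup_idem]
      rw [← sup_assoc, h2, h1]
    · rw [eq_bot_iff, ← hinf]
      intro x hx
      exact ⟨hx.1, hEcK x hx.2 (hEa hx.1).1⟩
    · have h1 : (L ⊔ C ⊓ E) ⊓ K ≤ Kc := fun x hx => hEcK x hx.1 hx.2
      exact (map_mono h1).trans (le_sup_right.trans le_sup_left)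

lemma ChainDecomposition.reindex {a : V →ₗ[𝕜] V} {N Y : Submodule 𝕜 V} {ιb ιc ιd ιb' ιd' : Type*}
    [Fintype ιb] [Fintype ιc] [Fintype ιd] [Fintype ιb'] [Fintype ιd'] {l : ιb → ℕ} {q : ιd → ℕ}
    {xb : ιb → ℕ → V} {xc : ιc → V} {xd : ιd → ℕ → V} (D : ChainDecomposition a N Y l q xb xc xd)
    (eb : ιb' ≃ ιb) (ed : ιd' ≃ ιd) :
    ChainDecomposition a N Y (l ∘ eb) (q ∘ ed) (xb ∘ eb) xc (xd ∘ ed) where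
  l_pos i := D.l_pos _
  q_pos i := D.q_pos _
  xb_eq_zero i k := D.xb_eq_zero _ k
  spanHeads_sup := by
    rw [← D.spanHeads_sup]
    exact congrArg₂ _ (congrArg (span 𝕜) (eb.surjective.range_comp fun i => xb i 0))
      (congrArg (span 𝕜) (ed.surjective.range_comp fun i => xd i 0))
  xb_mem i k := D.xb_mem _ k
  xd_mem i k := D.xd_mem _ k
  map_xb i k := D.map_xb _ k
  map_xd i k := D.map_xd _ k
  map_xc := D.map_xc
  indep α ξ hξ h := by
    have h1 := D.indep (α ∘ ed.symm) ξ hξ (by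
      rw [← Equiv.sum_comp ed]
      simpa using h)
    funext i
    have := congrFun h1 (ed i)
    simpa using this
  span_eq_top := by
    rw [eq_top_iff, ← D.span_eq_top]
    refine sup_le_sup (sup_le_sup_right (span_le.2 ?_) _) (span_le.2 ?_)
    · rintro _ ⟨⟨i, k⟩, rfl⟩
      obtain ⟨i, rfl⟩ := eb.surjective i
      exact subset_span ⟨⟨i, k⟩, rfl⟩
    · rintro _ ⟨⟨i, k⟩, rfl⟩
      obtain ⟨i, rfl⟩ := ed.surjective i
      exact subset_span ⟨⟨i, k⟩, rfl⟩
  card_le := by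
    have h1 : ∑ i, (l ∘ eb) i = ∑ i, l i := Equiv.sum_comp eb l
    have h2 : ∑ i, (q ∘ ed) i = ∑ i, q i := Equiv.sum_comp ed q
    rw [h1, h2]
    exact D.card_le
  card_heads_le := by
    rw [Fintype.card_congr eb, Fintype.card_congr ed]
    exact D.card_heads_le

lemma exists_equiv_antitone {ι : Type*} [Fintype ι] (q : ι → ℕ) :
    ∃ e : Fin (Fintype.card ι) ≃ ι, Antitone (q ∘ e) := by
  let e := (Fintype.equivFin ι).symm
  let s := Tuple.sort (q ∘ e)
  refine ⟨(Fin.revPerm.trans s).trans e, fun i j hij => ?_⟩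
  exact Tuple.monotone_sort (q ∘ e) (Fin.rev_le_rev.2 hij)

/-- The chains that end with an input can be corrected by covectors of the other chains, so that
only their own outputs are injected. -/
lemma ChainDecomposition.exists_correction {a : V →ₗ[𝕜] V} {N Y : Submodule 𝕜 V} {ιb ιc ιd : Type*}
    [Fintype ιb] [Fintype ιc] [Fintype ιd] {l : ιb → ℕ} {q : ιd → ℕ}
    {xb : ιb → ℕ → V} {xc : ιc → V} {xd : ιd → ℕ → V} (D : ChainDecomposition a N Y l q xb xc xd) :
    ∃ xd' : ιd → ℕ → V, ChainDecomposition a N Y l q xb xc xd' ∧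
      ∀ i k, k + 1 < q i → a (xd' i k) - xd' i (k + 1) ∈ spanHeads 𝕜 xd' := by
  set X := spanChains 𝕜 l xb with hX
  have hY : Y ≤ X ⊔ spanHeads 𝕜 xd := by
    rw [← D.spanHeads_sup]
    exact sup_le_sup_right (spanHeads_le_spanChains D.l_pos _) _
  have hxb : ∀ i k, xb i k ∈ X := by
    intro i k
    rcases lt_or_ge k (l i) with h | h
    · exact mem_spanChains xb i h
    · rw [D.xb_eq_zero i k h]
      exact zero_mem _
  have hXN : X ≤ N := by
    rw [hX, span_le]
    rintro _ ⟨c, rfl⟩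
    exact D.xb_mem _ _
  have haX : X ≤ (X ⊔ spanHeads 𝕜 xd).comap a := by
    rw [hX, span_le]
    rintro _ ⟨⟨i, k⟩, rfl⟩
    have := add_mem (hY (D.map_xb i k)) (mem_sup_left (hxb i (k + 1)))
    rwa [sub_add_cancel] at this
  -- The correction at component `k + 1` absorbs the part in `X` of the derivative of the corrected
  -- component `k`. Past the end of a chain the value is irrelevant.
  have step : ∀ i k (β : X), ∃ β' : X, k + 1 < q i →
      a (xd i k + β) - (xd i (k + 1) + β') ∈ spanHeads 𝕜 xd := by
    intro i k β
    by_cases h : k + 1 < q i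
    · obtain ⟨β', hβ', y, hy, e⟩ := mem_sup.1 (add_mem (hY (D.map_xd i k h)) (haX β.2))
      refine ⟨⟨β', hβ'⟩, fun _ => ?_⟩
      have : a (xd i k + β) - (xd i (k + 1) + β') = y := by
        rw [← add_right_inj β', e, map_add]
        abel
      rwa [this]
    · exact ⟨0, fun h' => absurd h' h⟩
  choose next hnext using step
  -- Starting from zero keeps the heads, and thus the output covectors, unchanged.
  obtain ⟨β, hβ0, hβX, hβ⟩ : ∃ β : ιd → ℕ → V, (∀ i, β i 0 = 0) ∧ (∀ i k, β i k ∈ X) ∧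
      ∀ i k, k + 1 < q i → a (xd i k + β i k) - (xd i (k + 1) + β i (k + 1)) ∈ spanHeads 𝕜 xd :=
    ⟨fun i k => (Nat.rec (0 : X) (fun k b => next i k b) k : X).1, fun i => rfl,
      fun i k => Subtype.property _, fun i k h => hnext i k _ h⟩
  let xd' : ιd → ℕ → V := fun i k => xd i k + β i k
  have hheads : (fun i => xd' i 0) = fun i => xd i 0 := by
    funext i
    simp [xd', hβ0]
  refine ⟨xd', ⟨D.l_pos, D.q_pos, D.xb_eq_zero, ?_, D.xb_mem, ?_, D.map_xb, ?_, D.map_xc, ?_, ?_,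
    D.card_le, D.card_heads_le⟩, ?_⟩
  · rw [spanHeads, spanHeads, hheads]
    exact D.spanHeads_sup
  · exact fun i k h => add_mem (D.xd_mem i k h) (hXN (hβX i k))
  · intro i k h
    have h1 : spanHeads 𝕜 xd ≤ Y := D.spanHeads_sup ▸ le_sup_right
    exact h1 (hβ i k h)
  · intro α ξ hξ h
    refine D.indep α ξ hξ ?_
    have h1 : ∑ i, α i • β i (q i - 1) ∈ N :=
      sum_mem fun i _ => smul_mem _ _ (hXN (hβX i _))
    have h2 := sub_mem h h1
    simp only [xd', smul_add, Finset.sum_add_distrib] at h2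
    convert h2 using 1
    abel
  · rw [eq_top_iff, ← D.span_eq_top]
    refine sup_le le_sup_left (span_le.2 ?_)
    rintro _ ⟨⟨i, k⟩, rfl⟩
    have h1 : xd' i k ∈ X ⊔ span 𝕜 (Set.range xc) ⊔ spanChains 𝕜 q xd' :=
      mem_sup_right (mem_spanChains xd' i k.2)
    have h2 := sub_mem h1 (mem_sup_left (mem_sup_left (hβX i k)))
    simpa [xd'] using h2
  · intro i k h
    rw [spanHeads, hheads]
    exact hβ i k h

/-- State covectors that are the coordinates of a special coordinate basis. Here `a` maps a covector
to its derivative along the autonomous dynamics, `N` consists of the covectors whose derivative is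
not affected by the input, and `Y` of the output covectors. -/
structure SCBCovectors (a : V →ₗ[𝕜] V) (N Y : Submodule 𝕜 V) {na nc pb md : ℕ} (l : Fin pb → ℕ)
    (q : Fin md → ℕ) (xa : Fin na → V) (xb : Fin pb → ℕ → V) (xc : Fin nc → V)
    (xd : Fin md → ℕ → V) : Prop where
  l_pos : ∀ i, 0 < l i
  q_pos : ∀ i, 0 < q i
  antitone_q : Antitone q
  xb_eq_zero : ∀ i k, l i ≤ k → xb i k = 0
  spanHeads_sup : spanHeads 𝕜 xb ⊔ spanHeads 𝕜 xd = Y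
  xa_mem : ∀ i, xa i ∈ N
  xb_mem : ∀ i k, xb i k ∈ N
  xd_mem : ∀ i k, k + 1 < q i → xd i k ∈ N
  map_xa : ∀ i, a (xa i) ∈ span 𝕜 (Set.range xa) ⊔ Y
  map_xb : ∀ i k, a (xb i k) - xb i (k + 1) ∈ Y
  map_xc : ∀ i, a (xc i) ∈ span 𝕜 (Set.range xa) ⊔ span 𝕜 (Set.range xc) ⊔ Y
  map_of_mem_span_xc : ∀ ξ ∈ span 𝕜 (Set.range xc), ξ ∈ N → a ξ ∈ span 𝕜 (Set.range xc) ⊔ Y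
  map_xd : ∀ i k, k + 1 < q i → a (xd i k) - xd i (k + 1) ∈ spanHeads 𝕜 xd
  indep : ∀ (α : Fin md → 𝕜), ∀ ξ ∈ span 𝕜 (Set.range xc),
    ∑ i, α i • xd i (q i - 1) + ξ ∈ N → α = 0
  span_eq_top : span 𝕜 (Set.range xa) ⊔ spanChains 𝕜 l xb ⊔ span 𝕜 (Set.range xc) ⊔
    spanChains 𝕜 q xd = ⊤
  card_le : na + ∑ i, l i + nc + ∑ i, q i ≤ finrank 𝕜 V

/-- The invariant splitting is applied to the span of `xc`, with the covectors in `N` as `K`. The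
invariant part becomes `xa`; the other part becomes `xc`, and its elements in `N` have derivatives
free of `xa`. -/
theorem exists_scbCovectors {V : Type} [AddCommGroup V] [Module 𝕜 V] [FiniteDimensional 𝕜 V]
    (a : V →ₗ[𝕜] V) (N Y : Submodule 𝕜 V) :
    ∃ (na nc pb md : ℕ) (l : Fin pb → ℕ) (q : Fin md → ℕ) (xa : Fin na → V) (xb : Fin pb → ℕ → V)
      (xc : Fin nc → V) (xd : Fin md → ℕ → V), SCBCovectors a N Y l q xa xb xc xd := by
  obtain ⟨ιb, ιc, ιd, _, _, _, l, q, xb, xc, xd, D⟩ :=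
    exists_chainDecomposition (finrank 𝕜 V) V le_rfl a N Y
  obtain ⟨e, he⟩ := exists_equiv_antitone q
  obtain ⟨xd', D', hD'⟩ := (D.reindex (Fintype.equivFin ιb).symm e).exists_correction
  classical
  set θ : (ιc → 𝕜) →ₗ[𝕜] V := Fintype.linearCombination 𝕜 xc with hθ
  have hθr : LinearMap.range θ = span 𝕜 (Set.range xc) := Fintype.range_linearCombination 𝕜 xc
  -- The derivative preserves the span of `xc` only modulo `Y`, so it is lifted to an endomorphism
  -- of the coefficient space.
  obtain ⟨f, hf⟩ : ∃ f : (ιc → 𝕜) →ₗ[𝕜] (ιc → 𝕜), ∀ w, a (θ w) - θ (f w) ∈ Y := by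
    have h1 : ∀ i, ∃ w, a (xc i) - θ w ∈ Y := by
      intro i
      obtain ⟨u, hu, y, hy, h⟩ := mem_sup.1 (D'.map_xc i)
      rw [← hθr] at hu
      obtain ⟨w, rfl⟩ := hu
      exact ⟨w, by rw [← h, add_sub_cancel_left]; exact hy⟩
    choose w hw using h1
    refine ⟨(Pi.basisFun 𝕜 ιc).constr 𝕜 w, ?_⟩
    suffices h : ⊤ ≤ Y.comap (a ∘ₗ θ - θ ∘ₗ (Pi.basisFun 𝕜 ιc).constr 𝕜 w) from
      fun v => h (mem_top : v ∈ ⊤)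
    rw [← (Pi.basisFun 𝕜 ιc).span_eq, span_le]
    rintro _ ⟨i, rfl⟩
    have h2 : θ (Pi.basisFun 𝕜 ιc i) = xc i := by
      simp [hθ, Fintype.linearCombination_apply_single]
    change a (θ _) - θ ((Pi.basisFun 𝕜 ιc).constr 𝕜 w _) ∈ Y
    rw [Basis.constr_basis, h2]
    exact hw i
  obtain ⟨Ea, Ec, hsup, hinf, hEa, hfEa, hfEc⟩ := exists_invariant_splitting f _ ⊤ (N.comap θ)
    le_rfl le_top le_top
  let ba := finBasis 𝕜 Ea
  let bc := finBasis 𝕜 Ec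
  have span_map : ∀ {m : ℕ} (E : Submodule 𝕜 (ιc → 𝕜)) (b : Basis (Fin m) 𝕜 E),
      span 𝕜 (Set.range fun i => θ (b i)) = E.map θ := by
    intro m E b
    have h1 : (Set.range fun i => θ (b i)) = (θ ∘ₗ E.subtype) '' Set.range b := by
      rw [← Set.range_comp]
      rfl
    rw [h1, ← LinearMap.map_span, b.span_eq, Submodule.map_comp, map_subtype_top]
  have hsupθ : Ea.map θ ⊔ Ec.map θ = span 𝕜 (Set.range xc) := by
    rw [← Submodule.map_sup, hsup, ← hθr, LinearMap.range_eq_map]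
  have hcle : Ec.map θ ≤ span 𝕜 (Set.range xc) := hsupθ ▸ le_sup_right
  have map_mem : ∀ w (E : Submodule 𝕜 (ιc → 𝕜)), f w ∈ E → a (θ w) ∈ E.map θ ⊔ Y := by
    intro w E h
    have := add_mem_sup (mem_map_of_mem h : θ (f w) ∈ E.map θ) (hf w)
    rwa [add_sub_cancel] at this
  refine ⟨_, _, _, _, _, _, fun i => θ (ba i), _, fun i => θ (bc i), xd', D'.l_pos, D'.q_pos, he,
    D'.xb_eq_zero, D'.spanHeads_sup, fun i => hEa (ba i).2, D'.xb_mem, D'.xd_mem, ?_, D'.map_xb,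
    ?_, ?_, hD', ?_, ?_, ?_⟩
  · intro i
    rw [span_map]
    exact map_mem _ _ (hfEa ⟨_, (ba i).2, rfl⟩)
  · intro i
    rw [span_map, span_map, ← Submodule.map_sup, hsup]
    exact map_mem _ _ mem_top
  · intro ξ hξ hN
    rw [span_map] at hξ ⊢
    obtain ⟨w, hw, rfl⟩ := hξ
    exact map_mem _ _ (hfEc ⟨w, ⟨hw, hN⟩, rfl⟩)
  · intro α ξ hξ h
    rw [span_map] at hξ
    exact D'.indep α ξ (hcle hξ) h
  · rw [← D'.span_eq_top, ← hsupθ, span_map, span_map]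
    ac_rfl
  · have h1 := D'.card_le
    have h2 := finrank_sup_add_finrank_inf_eq Ea Ec
    rw [hsup, hinf, finrank_bot, finrank_top, finrank_fintype_fun_eq_card] at h2
    omega

end SCBCovectors

/-! ### Adapted bases of state, input and output covectors -/

section SCBBases

open Module Submodule

variable {𝕜 V W P : Type} [Field 𝕜] [AddCommGroup V] [Module 𝕜 V] [AddCommGroup W] [Module 𝕜 W]
  [AddCommGroup P] [Module 𝕜 P]

lemma map_le_span_basis {ι : Type*} (f : V →ₗ[𝕜] W) {E : Submodule 𝕜 V} (e : Basis ι 𝕜 E) :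
    E.map f ≤ span 𝕜 (Set.range fun i => f (e i)) := by
  have h : (Set.range fun i => f (e i)) = (f ∘ₗ E.subtype) '' Set.range e := by
    rw [← Set.range_comp]
    rfl
  rw [h, ← LinearMap.map_span, e.span_eq, Submodule.map_comp, map_subtype_top]

/-- The family of state covectors indexed by the state coordinates of a special coordinate basis. -/
def scbFamily {na nc pb md : ℕ} (l : Fin pb → ℕ) (q : Fin md → ℕ) (xa : Fin na → V)
    (xb : Fin pb → ℕ → V) (xc : Fin nc → V) (xd : Fin md → ℕ → V) : SCBState na nc l q → V :=
  Sum.elim xa (Sum.elim (fun c => xb c.1 c.2) (Sum.elim xc fun c => xd c.1 c.2))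

lemma SCBCovectors.top_le_span {a : V →ₗ[𝕜] V} {N Y : Submodule 𝕜 V} {na nc pb md : ℕ}
    {l : Fin pb → ℕ} {q : Fin md → ℕ} {xa : Fin na → V} {xb : Fin pb → ℕ → V} {xc : Fin nc → V}
    {xd : Fin md → ℕ → V} (S : SCBCovectors a N Y l q xa xb xc xd) :
    ⊤ ≤ span 𝕜 (Set.range (scbFamily l q xa xb xc xd)) := by
  rw [← S.span_eq_top]
  refine sup_le (sup_le (sup_le ?_ ?_) ?_) ?_ <;> refine span_mono ?_ <;> rintro _ ⟨i, rfl⟩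
  · exact ⟨Sum.inl i, rfl⟩
  · exact ⟨Sum.inr (Sum.inl i), rfl⟩
  · exact ⟨Sum.inr (Sum.inr (Sum.inl i)), rfl⟩
  · exact ⟨Sum.inr (Sum.inr (Sum.inr i)), rfl⟩

lemma SCBCovectors.card_eq [FiniteDimensional 𝕜 V] {a : V →ₗ[𝕜] V} {N Y : Submodule 𝕜 V}
    {na nc pb md : ℕ} {l : Fin pb → ℕ} {q : Fin md → ℕ} {xa : Fin na → V} {xb : Fin pb → ℕ → V}
    {xc : Fin nc → V} {xd : Fin md → ℕ → V} (S : SCBCovectors a N Y l q xa xb xc xd) :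
    Fintype.card (SCBState na nc l q) = finrank 𝕜 V := by
  refine le_antisymm ?_ ?_
  · have h := S.card_le
    simp only [Fintype.card_sum, Fintype.card_fin, Fintype.card_sigma]
    omega
  · have h := finrank_range_le_card (R := 𝕜) (scbFamily l q xa xb xc xd)
    rwa [Set.finrank, top_le_iff.1 S.top_le_span, finrank_top] at h

/-- The inputs $u_0$ come from the range of `d`. Modulo it, the inputs $u_d$ are those at the ends
of the chains (d) and the inputs $u_c$ those that reach `xc`: independent by `indep`, and exhaustive
by `hsurj` because all other covectors lie in `N`. The outputs $y_d$, $y_b$ are preimages in `ker d`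
of the heads of the chains. -/
theorem exists_scb_bases [FiniteDimensional 𝕜 V] [FiniteDimensional 𝕜 W]
    (a : V →ₗ[𝕜] V) (b : V →ₗ[𝕜] W) (c : P →ₗ[𝕜] V) (d : P →ₗ[𝕜] W)
    (hsurj : ∀ w, ∃ x y, b x + d y = w) (hinj : ∀ y, c y = 0 → d y = 0 → y = 0)
    {m₀ : ℕ} (hd : finrank 𝕜 (LinearMap.range d) = m₀) :
    ∃ (ψ : W →ₗ[𝕜] P) (na nc mc pb md : ℕ) (l : Fin pb → ℕ) (q : Fin md → ℕ) (xa : Fin na → V)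
      (xb : Fin pb → ℕ → V) (xc : Fin nc → V) (xd : Fin md → ℕ → V)
      (bx : Basis (SCBState na nc l q) 𝕜 V) (bu : Basis (SCBInput m₀ md mc) 𝕜 W)
      (bp : Basis (SCBOutput m₀ md pb) 𝕜 P),
      SCBCovectors (a - c ∘ₗ ψ ∘ₗ b) ((LinearMap.range d).comap b) ((LinearMap.ker d).map c)
        l q xa xb xc xd ∧
      (∀ r, bx r = scbFamily l q xa xb xc xd r) ∧
      (∀ j, d (bp (Sum.inl j)) = bu (Sum.inl j)) ∧
      (∀ j, d (bp (Sum.inr j)) = 0) ∧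
      (∀ j, c (bp (Sum.inr (Sum.inl j))) = xd j 0) ∧
      (∀ j, c (bp (Sum.inr (Sum.inr j))) = xb j 0) ∧
      (∀ j, ψ (bu (Sum.inl j)) = bp (Sum.inl j)) ∧
      (∀ j, ψ (bu (Sum.inr j)) = 0) ∧
      (∀ i, b (xd i (q i - 1)) - bu (Sum.inr (Sum.inl i)) ∈ LinearMap.range d) ∧
      (∀ ξ ∈ span 𝕜 (Set.range xc), ∃ w ∈ span 𝕜 (Set.range fun j => bu (Sum.inr (Sum.inr j))),
        b ξ - w ∈ LinearMap.range d) ∧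
      (∀ j, ∃ ξ ∈ span 𝕜 (Set.range xc), b ξ - bu (Sum.inr (Sum.inr j)) ∈ LinearMap.range d) := by
  set W0 := LinearMap.range d with hW0
  obtain ⟨W1, hW⟩ := Submodule.exists_isCompl W0
  obtain ⟨s, hs⟩ := d.rangeRestrict.exists_rightInverse_of_surjective d.range_rangeRestrict
  have hs' : ∀ w : W0, d (s w) = w := fun w => congrArg Subtype.val (LinearMap.congr_fun hs w)
  set π0 := W0.projectionOnto W1 hW with hπ0
  set π1 := W1.projectionOnto W0 hW.symm with hπ1
  have π0_left : ∀ w : W0, π0 w = w := fun w => projectionOnto_apply_left hW w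
  have π0_right : ∀ w : W1, π0 w = 0 := fun w => projectionOnto_apply_right hW w
  have π1_left : ∀ w : W1, π1 w = w := fun w => projectionOnto_apply_left hW.symm w
  have π1_zero : ∀ w, π1 w = 0 ↔ w ∈ W0 := fun w => projectionOnto_apply_eq_zero_iff hW.symm
  have sub_π1 : ∀ w, w - π1 w ∈ W0 := fun w => by
    rw [← π1_zero, map_sub, π1_left, sub_self]
  -- A generalised inverse of `d`; subtracting `c ∘ₗ ψ ∘ₗ b` removes the term $B_0C_0$ from the
  -- dynamics.
  set ψ : W →ₗ[𝕜] P := s ∘ₗ π0 with hψ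
  obtain ⟨na, nc, pb, md, l, q, xa, xb, xc, xd, S⟩ := exists_scbCovectors (a - c ∘ₗ ψ ∘ₗ b)
    (W0.comap b) ((LinearMap.ker d).map c)
  have hbY : ∀ j, xb j 0 ∈ (LinearMap.ker d).map c := fun j =>
    S.spanHeads_sup ▸ mem_sup_left (subset_span ⟨j, rfl⟩)
  have hdY : ∀ j, xd j 0 ∈ (LinearMap.ker d).map c := fun j =>
    S.spanHeads_sup ▸ mem_sup_right (subset_span ⟨j, rfl⟩)
  choose yb hyb0 hyb using hbY
  choose yd hyd0 hyd using hdY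
  let bx := basisOfTopLeSpanOfCardEqFinrank (scbFamily l q xa xb xc xd) S.top_le_span S.card_eq
  have hbx : ∀ r, bx r = scbFamily l q xa xb xc xd r := fun r => by
    rw [coe_basisOfTopLeSpanOfCardEqFinrank]
  let u0 : Basis (Fin m₀) 𝕜 W0 := finBasisOfFinrankEq 𝕜 W0 hd
  set Wc : Submodule 𝕜 W1 := (span 𝕜 (Set.range xc)).map (π1 ∘ₗ b) with hWc
  let uc := finBasis 𝕜 Wc
  let u : SCBInput m₀ md (finrank 𝕜 Wc) → W := Sum.elim (fun j => u0 j)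
    (Sum.elim (fun i => π1 (b (xd i (q i - 1)))) fun j => ((uc j : W1) : W))
  have hWc_span : Wc.map W1.subtype ≤ span 𝕜 (Set.range fun j => ((uc j : W1) : W)) :=
    map_le_span_basis W1.subtype uc
  have hu_li : LinearIndependent 𝕜 u := by
    rw [Fintype.linearIndependent_iff]
    intro g hg
    rw [Fintype.sum_sum_type, Fintype.sum_sum_type] at hg
    set w0 : W0 := ∑ j, g (Sum.inl j) • u0 j with hw0
    set wc : Wc := ∑ j, g (Sum.inr (Sum.inr j)) • uc j with hwc
    set x : V := ∑ i, g (Sum.inr (Sum.inl i)) • xd i (q i - 1) with hx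
    have e : (w0 : W) + ((π1 (b x) + wc : W1) : W) = 0 := by
      rw [← hg, hw0, hwc, hx]
      simp only [map_sum, map_smul, coe_sum, coe_smul, coe_add]
      rfl
    have h0 : w0 = 0 := by
      have := congrArg π0 e
      rwa [map_add, π0_left, π0_right, add_zero, map_zero] at this
    have h1 : π1 (b x) + (wc : W1) = 0 := by
      rw [h0, ZeroMemClass.coe_zero, zero_add] at e
      exact Subtype.ext e
    obtain ⟨ξ, hξ, hξ'⟩ := wc.2
    have h2 : x + ξ ∈ W0.comap b := by
      rw [mem_comap, ← π1_zero, map_add, map_add, ← h1, ← hξ']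
      rfl
    have h3 := S.indep (fun i => g (Sum.inr (Sum.inl i))) ξ hξ h2
    have h4 : wc = 0 := by
      have hx0 : x = 0 := by
        rw [hx]
        exact Finset.sum_eq_zero fun i _ => by rw [congrFun h3 i, Pi.zero_apply, zero_smul]
      rw [hx0, map_zero, map_zero, zero_add] at h1
      exact Subtype.ext h1
    rintro (j | j | j)
    · exact Fintype.linearIndependent_iff.1 u0.linearIndependent _ h0 j
    · exact congrFun h3 j
    · exact Fintype.linearIndependent_iff.1 uc.linearIndependent _ h4 j
  have hu_span : ⊤ ≤ span 𝕜 (Set.range u) := by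
    set T := span 𝕜 (Set.range u) with hT
    have h0 : W0 ≤ T := by
      rw [← map_subtype_top W0, ← u0.span_eq, map_span, span_le]
      rintro _ ⟨_, ⟨j, rfl⟩, rfl⟩
      exact subset_span ⟨Sum.inl j, rfl⟩
    have hN : ∀ x, x ∈ W0.comap b → ((π1 (b x) : W1) : W) ∈ T := by
      intro x hx
      rw [(π1_zero _).2 hx]
      exact zero_mem _
    have hc : Wc.map W1.subtype ≤ T := by
      refine hWc_span.trans (span_mono ?_)
      rintro _ ⟨j, rfl⟩
      exact ⟨Sum.inr (Sum.inr j), rfl⟩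
    have h1 : ⊤ ≤ T.comap (W1.subtype ∘ₗ π1 ∘ₗ b) := by
      rw [← S.span_eq_top]
      refine sup_le (sup_le (sup_le (span_le.2 ?_) (span_le.2 ?_)) ?_) (span_le.2 ?_)
      · rintro _ ⟨i, rfl⟩
        exact hN _ (S.xa_mem i)
      · rintro _ ⟨⟨i, k⟩, rfl⟩
        exact hN _ (S.xb_mem i k)
      · exact fun ξ hξ => hc ⟨_, ⟨ξ, hξ, rfl⟩, rfl⟩
      · rintro _ ⟨⟨i, k⟩, rfl⟩
        by_cases hk : (k : ℕ) + 1 < q i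
        · exact hN _ (S.xd_mem i k hk)
        · have hk' : (k : ℕ) = q i - 1 := by have := k.2; omega
          refine subset_span ⟨Sum.inr (Sum.inl i), ?_⟩
          simp [u, hk']
    intro w _
    obtain ⟨x, y, h⟩ := hsurj w
    have h2 : ((π1 (b x) : W1) : W) ∈ T := h1 (mem_top : x ∈ ⊤)
    have h3 := add_mem (add_mem (h0 (sub_π1 (b x))) h2) (h0 ⟨y, rfl⟩)
    rwa [sub_add_cancel, h] at h3
  let y : SCBOutput m₀ md pb → P := Sum.elim (fun j => s (u0 j)) (Sum.elim yd yb)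
  have hy_li : LinearIndependent 𝕜 y := by
    rw [Fintype.linearIndependent_iff]
    intro g hg
    rw [Fintype.sum_sum_type] at hg
    have h0 : ∀ j, g (Sum.inl j) = 0 := by
      -- Applying `d` isolates the coefficients of $y_0$; applying `c` then leaves a relation among
      -- heads of chains, which belong to the basis `bx`.
      refine Fintype.linearIndependent_iff.1 u0.linearIndependent _ (Subtype.ext ?_)
      have h := congrArg d hg
      have h' : d (∑ j, g (Sum.inr j) • y (Sum.inr j)) = 0 := by
        rw [map_sum]
        refine Finset.sum_eq_zero fun j _ => ?_
        rcases j with j | j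
        · rw [map_smul, show d (y (Sum.inr (Sum.inl j))) = 0 from hyd0 j, smul_zero]
        · rw [map_smul, show d (y (Sum.inr (Sum.inr j))) = 0 from hyb0 j, smul_zero]
      rw [map_add, h', add_zero, map_zero, map_sum] at h
      simp only [coe_sum, coe_smul, ZeroMemClass.coe_zero, ← h]
      exact Finset.sum_congr rfl fun j _ => by rw [map_smul, ← hs' (u0 j)]; rfl
    let idx : Fin md ⊕ Fin pb → SCBState na nc l q := Sum.elim
      (fun j => Sum.inr (Sum.inr (Sum.inr ⟨j, ⟨0, S.q_pos j⟩⟩)))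
      fun j => Sum.inr (Sum.inl ⟨j, ⟨0, S.l_pos j⟩⟩)
    have hidx : Function.Injective idx := by
      rintro (i | i) (j | j) h
      · simp only [idx, Sum.elim_inl, Sum.inr.injEq, Sigma.mk.injEq] at h
        rw [h.1]
      · simp [idx] at h
      · simp [idx] at h
      · simp only [idx, Sum.elim_inr, Sum.inr.injEq, Sum.inl.injEq, Sigma.mk.injEq] at h
        rw [h.1]
    have h1 : ∀ j, g (Sum.inr j) = 0 := by
      refine Fintype.linearIndependent_iff.1 (bx.linearIndependent.comp idx hidx) _ ?_
      rw [Finset.sum_eq_zero fun j _ => by rw [h0 j, zero_smul], zero_add] at hg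
      have h := congrArg c hg
      rw [map_zero, map_sum] at h
      rw [← h]
      refine Finset.sum_congr rfl fun j _ => ?_
      rw [map_smul, Function.comp_apply, hbx]
      rcases j with j | j
      · exact congrArg _ (hyd j).symm
      · exact congrArg _ (hyb j).symm
    rintro (j | j)
    · exact h0 j
    · exact h1 j
  have hy_span : ⊤ ≤ span 𝕜 (Set.range y) := by
    set T := span 𝕜 (Set.range y) with hT
    have h0 : LinearMap.range s ≤ T := by
      rw [LinearMap.range_eq_map, ← u0.span_eq, map_span, span_le]
      rintro _ ⟨_, ⟨j, rfl⟩, rfl⟩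
      exact subset_span ⟨Sum.inl j, rfl⟩
    have h1 : (LinearMap.ker d).map c ≤ (T ⊓ LinearMap.ker d).map c := by
      rw [← S.spanHeads_sup]
      refine sup_le (span_le.2 ?_) (span_le.2 ?_)
      · rintro _ ⟨j, rfl⟩
        exact ⟨yb j, ⟨subset_span ⟨Sum.inr (Sum.inr j), rfl⟩, hyb0 j⟩, hyb j⟩
      · rintro _ ⟨j, rfl⟩
        exact ⟨yd j, ⟨subset_span ⟨Sum.inr (Sum.inl j), rfl⟩, hyd0 j⟩, hyd j⟩
    intro v _
    have hv : d (v - s ⟨d v, ⟨v, rfl⟩⟩) = 0 := by rw [map_sub, hs', sub_self]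
    obtain ⟨v', ⟨hv'T, hv'd⟩, hv'c⟩ := h1 ⟨_, hv, rfl⟩
    have h2 : v - s ⟨d v, ⟨v, rfl⟩⟩ - v' = 0 := by
      refine hinj _ ?_ ?_
      · rw [map_sub, hv'c, sub_self]
      · rw [map_sub, hv, LinearMap.mem_ker.1 hv'd, sub_self]
    rw [sub_eq_zero, sub_eq_iff_eq_add] at h2
    rw [h2]
    exact add_mem hv'T (h0 ⟨_, rfl⟩)
  refine ⟨ψ, na, nc, _, pb, md, l, q, xa, xb, xc, xd, bx, Basis.mk hu_li hu_span,
    Basis.mk hy_li hy_span, S, hbx, ?_, ?_, ?_, ?_, ?_, ?_, ?_, ?_, ?_⟩ <;>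
    simp only [Basis.mk_apply]
  · exact fun j => hs' _
  · rintro (j | j)
    · exact hyd0 j
    · exact hyb0 j
  · exact hyd
  · exact hyb
  · intro j
    change s (π0 (u0 j)) = s (u0 j)
    rw [π0_left]
  · rintro (j | j)
    · change s (π0 (π1 (b _) : W1)) = 0
      rw [π0_right, map_zero]
    · change s (π0 (uc j : W1)) = 0
      rw [π0_right, map_zero]
  · exact fun i => sub_π1 _
  · intro ξ hξ
    refine ⟨π1 (b ξ), ?_, sub_π1 _⟩
    exact hWc_span ⟨_, ⟨ξ, hξ, rfl⟩, rfl⟩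
  · intro j
    obtain ⟨ξ, hξ, h⟩ := (uc j).2
    refine ⟨ξ, hξ, ?_⟩
    change b ξ - ((uc j : W1) : W) ∈ W0
    rw [← h]
    exact sub_π1 _

end SCBBases

/-! ### From covector relations to the matrices of the SCB form -/

section Realization

open Module Submodule

/-- The change-of-coordinates matrix whose inverse has the given basis of covectors as its rows. -/
noncomputable def covectorTransformation {α β : Type*} [Fintype α] [DecidableEq α]
    (e : Basis β ℝ (α → ℝ)) : Matrix α β ℝ :=
  (e.toMatrix (Pi.basisFun ℝ α))ᵀ

lemma of_mul_covectorTransformation {α β : Type*} [Fintype α] [DecidableEq α] [DecidableEq β]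
    (e : Basis β ℝ (α → ℝ)) : Matrix.of e * covectorTransformation e = 1 := by
  rw [covectorTransformation, ← Matrix.transpose_inj, Matrix.transpose_mul, transpose_transpose,
    transpose_one, ← e.toMatrix_mul_toMatrix_flip (Pi.basisFun ℝ α)]
  rfl

lemma covectorTransformation_mul_of {α β : Type*} [Fintype α] [DecidableEq α] [Fintype β]
    [DecidableEq β] (e : Basis β ℝ (α → ℝ)) : covectorTransformation e * Matrix.of e = 1 := by
  rw [covectorTransformation, ← Matrix.transpose_inj, Matrix.transpose_mul, transpose_transpose,
    transpose_one, ← (Pi.basisFun ℝ α).toMatrix_mul_toMatrix_flip e]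
  rfl

lemma isNonsingular_covectorTransformation {α β : Type*} [Fintype α] [DecidableEq α] [Fintype β]
    [DecidableEq β] (e : Basis β ℝ (α → ℝ)) : IsNonsingular (covectorTransformation e) :=
  ⟨Matrix.of e, covectorTransformation_mul_of e, of_mul_covectorTransformation e⟩

lemma mul_covectorTransformation {α β γ δ : Type*} [Fintype α] [DecidableEq α] [Fintype β]
    [DecidableEq β] [Fintype γ] [DecidableEq γ] [Fintype δ] [DecidableEq δ]
    (e : Basis β ℝ (α → ℝ)) (e' : Basis δ ℝ (γ → ℝ)) (M : Matrix α γ ℝ) (M' : Matrix β δ ℝ)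
    (h : ∀ i, e i ᵥ* M = ∑ j, M' i j • e' j) :
    M * covectorTransformation e' = covectorTransformation e * M' := by
  have h1 : Matrix.of e * M = M' * Matrix.of e' := by
    ext i k
    have := congrFun (h i) k
    rw [Finset.sum_apply] at this
    exact this
  calc M * covectorTransformation e'
      = covectorTransformation e * (Matrix.of e * M) * covectorTransformation e' := by
        rw [← Matrix.mul_assoc, covectorTransformation_mul_of, Matrix.one_mul]
    _ = covectorTransformation e * M' := by
        rw [h1, Matrix.mul_assoc, Matrix.mul_assoc, of_mul_covectorTransformation, Matrix.mul_one]

variable {M : Type*} [AddCommGroup M] [Module ℝ M]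

lemma sum_chainA_smul {N : ℕ} {q : Fin N → ℕ} (x : Fin N → ℕ → M) (i : Fin N) (k : Fin (q i)) :
    ∑ c : ChainIdx q, chainA q ⟨i, k⟩ c • x c.1 c.2 = if (k : ℕ) + 1 < q i then x i (k + 1) else 0 := by
  split_ifs with h
  · rw [Finset.sum_eq_single ⟨i, ⟨k + 1, h⟩⟩]
    · simp [chainA_apply]
    · rintro ⟨j, k'⟩ - hne
      rw [chainA_apply, if_neg, zero_smul]
      rintro ⟨rfl, hk⟩
      exact hne (by congr; exact Fin.ext hk.symm)
    · simp
  · refine Finset.sum_eq_zero ?_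
    rintro ⟨j, k'⟩ -
    rw [chainA_apply, if_neg, zero_smul]
    rintro ⟨rfl, hk⟩
    exact h (by have := k'.2; simp only at hk; omega)

lemma sum_chainC_smul {N : ℕ} {q : Fin N → ℕ} (hq : ∀ i, 0 < q i) (x : Fin N → ℕ → M)
    (i : Fin N) : ∑ c : ChainIdx q, chainC q i c • x c.1 c.2 = x i 0 := by
  rw [Finset.sum_eq_single ⟨i, ⟨0, hq i⟩⟩]
  · simp [chainC]
  · rintro ⟨j, k⟩ - hne
    simp only [chainC, of_apply]
    rw [if_neg, zero_smul]
    rintro ⟨rfl, hk⟩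
    exact hne (by congr; exact Fin.ext hk)
  · simp

lemma sum_mul_smul {α β γ : Type*} [Fintype β] [Fintype γ] (H : Matrix α β ℝ) (K : Matrix β γ ℝ)
    (x : γ → M) (i : α) : ∑ c, (H * K) i c • x c = ∑ j, H i j • ∑ c, K j c • x c := by
  simp only [Matrix.mul_apply, Finset.sum_smul, Finset.smul_sum, mul_smul]
  exact Finset.sum_comm

lemma sum_mul_chainC_smul {α : Type*} {N : ℕ} {q : Fin N → ℕ} (hq : ∀ i, 0 < q i)
    (H : Matrix α (Fin N) ℝ) (x : Fin N → ℕ → M) (i : α) :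
    ∑ c : ChainIdx q, (H * chainC q) i c • x c.1 c.2 = ∑ j, H i j • x j 0 := by
  rw [sum_mul_smul H (chainC q) fun c => x c.1 c.2]
  simp only [sum_chainC_smul hq]

lemma sum_chainB_mul_smul {α : Type*} [Fintype α] {N : ℕ} {q : Fin N → ℕ}
    (F : Matrix (Fin N) α ℝ) (x : α → M) (i : Fin N) (k : Fin (q i)) :
    ∑ c, (chainB q * F) ⟨i, k⟩ c • x c = if (k : ℕ) + 1 = q i then ∑ c, F i c • x c else 0 := by
  simp only [chainB_mul_apply]
  split_ifs <;> simp

end Realization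

section Realization

open Module Submodule

/-- Each relation among the covectors gives one block row. The delicate block is $B_cF_{ca}$: the
coefficients of `xa` in the derivative of `xc` must factor through `Bc`. -/
theorem exists_scbData {V W P : Type} [AddCommGroup V] [Module ℝ V] [AddCommGroup W] [Module ℝ W]
    [AddCommGroup P] [Module ℝ P] [FiniteDimensional ℝ V] [FiniteDimensional ℝ W]
    (a : V →ₗ[ℝ] V) (b : V →ₗ[ℝ] W) (c : P →ₗ[ℝ] V) (d : P →ₗ[ℝ] W)
    (hsurj : ∀ w, ∃ x y, b x + d y = w) (hinj : ∀ y, c y = 0 → d y = 0 → y = 0)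
    {m₀ : ℕ} (hd : finrank ℝ (LinearMap.range d) = m₀) :
    ∃ (na nc mc pb md : ℕ) (l : Fin pb → ℕ) (q : Fin md → ℕ) (Φ : SCBData m₀ na nc mc l q)
      (bx : Basis (SCBState na nc l q) ℝ V) (bu : Basis (SCBInput m₀ md mc) ℝ W)
      (bp : Basis (SCBOutput m₀ md pb) ℝ P),
      (∀ i, 0 < l i) ∧ (∀ i, 0 < q i) ∧ Antitone q ∧
      (∀ r, a (bx r) = ∑ r', Φ.toSystem.A r r' • bx r') ∧
      (∀ r, b (bx r) = ∑ j, Φ.toSystem.B r j • bu j) ∧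
      (∀ j, c (bp j) = ∑ r, Φ.toSystem.C j r • bx r) ∧
      (∀ j, d (bp j) = ∑ k, Φ.toSystem.D j k • bu k) := by
  obtain ⟨ψ, na, nc, mc, pb, md, l, q, xa, xb, xc, xd, bx, bu, bp, S, hbx, hdp0, hdp, hcd, hcb,
    hψ0, hψ, hud, huc, huc'⟩ := exists_scb_bases a b c d hsurj hinj hd
  set a' := a - c ∘ₗ ψ ∘ₗ b with ha'
  have hN : ∀ w ∈ LinearMap.range d, ∀ j, bu.repr w (Sum.inr j) = 0 := by
    rintro _ ⟨y, rfl⟩ j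
    have h : bu.coord (Sum.inr j) ∘ₗ d = 0 := by
      refine bp.ext fun k => ?_
      rcases k with k | k
      · simp [hdp0]
      · simp [hdp]
    exact LinearMap.congr_fun h y
  have hN' : ∀ w, (∀ j, bu.repr w (Sum.inr j) = 0) → w ∈ LinearMap.range d := by
    intro w h
    rw [← bu.sum_repr w, Fintype.sum_sum_type]
    refine add_mem (sum_mem fun j _ => smul_mem _ _ ⟨_, hdp0 j⟩) ?_
    rw [Finset.sum_eq_zero fun j _ => by rw [h j, zero_smul]]
    exact zero_mem _
  have hψ' : ∀ w, ψ w = ∑ j, bu.repr w (Sum.inl j) • bp (Sum.inl j) := by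
    intro w
    conv_lhs => rw [← bu.sum_repr w, map_sum, Fintype.sum_sum_type]
    simp only [map_smul, hψ0, hψ, smul_zero, Finset.sum_const_zero, add_zero]
  have ha : ∀ x, a x = a' x + ∑ j, bu.repr (b x) (Sum.inl j) • c (bp (Sum.inl j)) := by
    intro x
    have : c (ψ (b x)) = ∑ j, bu.repr (b x) (Sum.inl j) • c (bp (Sum.inl j)) := by
      rw [hψ', map_sum]
      exact Finset.sum_congr rfl fun j _ => map_smul _ _ _
    rw [← this, ha']
    simp
  have hY : ∀ y ∈ (LinearMap.ker d).map c, ∃ (g : Fin pb → ℝ) (h : Fin md → ℝ),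
      ∑ j, g j • xb j 0 + ∑ j, h j • xd j 0 = y := by
    intro y hy
    rw [← S.spanHeads_sup] at hy
    obtain ⟨y1, h1, y2, h2, rfl⟩ := mem_sup.1 hy
    obtain ⟨g, rfl⟩ := (mem_span_range_iff_exists_fun ℝ).1 h1
    obtain ⟨h, rfl⟩ := (mem_span_range_iff_exists_fun ℝ).1 h2
    exact ⟨g, h, rfl⟩
  have hXY : ∀ {k : ℕ} (x : Fin k → V), ∀ v ∈ span ℝ (Set.range x) ⊔ (LinearMap.ker d).map c,
      ∃ (f : Fin k → ℝ) (g : Fin pb → ℝ) (h : Fin md → ℝ),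
        ∑ j, f j • x j + (∑ j, g j • xb j 0 + ∑ j, h j • xd j 0) = v := by
    intro k x v hv
    obtain ⟨y1, h1, y2, h2, rfl⟩ := mem_sup.1 hv
    obtain ⟨f, rfl⟩ := (mem_span_range_iff_exists_fun ℝ).1 h1
    obtain ⟨g, h, rfl⟩ := hY y2 h2
    exact ⟨f, g, h, rfl⟩
  -- rows of subsystem (a)
  choose Aa Hab Had hAa using fun i => hXY xa _ (S.map_xa i)
  -- rows of subsystem (b)
  choose Hbb Hbd hAb using fun i k => hY _ (S.map_xb i k)
  -- rows of subsystem (c)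
  have hbc : ∀ ξ ∈ span ℝ (Set.range xc), ∀ j, bu.repr (b ξ) (Sum.inr (Sum.inl j)) = 0 := by
    intro ξ hξ j
    obtain ⟨w, hw, h⟩ := huc ξ hξ
    have h1 : span ℝ (Set.range fun j => bu (Sum.inr (Sum.inr j))) ≤
        LinearMap.ker (bu.coord (Sum.inr (Sum.inl j))) := by
      rw [span_le]
      rintro _ ⟨k, rfl⟩
      simp
    have h2 : bu.repr w (Sum.inr (Sum.inl j)) = 0 := h1 hw
    have h3 := hN _ h (Sum.inl j)
    rw [map_sub, Finsupp.sub_apply, h2, sub_zero] at h3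
    exact h3
  have hac : span ℝ (Set.range xc) ≤
      (span ℝ (Set.range xa) ⊔ span ℝ (Set.range xc) ⊔ (LinearMap.ker d).map c).comap a' := by
    rw [span_le]
    rintro _ ⟨i, rfl⟩
    exact S.map_xc i
  -- Row `j` of `Fca` is read off from a covector `ξ` whose only input besides $u_0$ is the `j`-th
  -- component of $u_c$.
  have hF : ∀ j, ∃ ξ ∈ span ℝ (Set.range xc), ∃ F : Fin na → ℝ,
      b ξ - bu (Sum.inr (Sum.inr j)) ∈ LinearMap.range d ∧
      a' ξ - ∑ k, F k • xa k ∈ span ℝ (Set.range xc) ⊔ (LinearMap.ker d).map c := by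
    intro j
    obtain ⟨ξ, hξ, h⟩ := huc' j
    have h1 : a' ξ ∈ span ℝ (Set.range xa) ⊔ (span ℝ (Set.range xc) ⊔ (LinearMap.ker d).map c) := by
      rw [← sup_assoc]
      exact hac hξ
    obtain ⟨y1, hy1, y2, hy2, e⟩ := mem_sup.1 h1
    obtain ⟨F, rfl⟩ := (mem_span_range_iff_exists_fun ℝ).1 hy1
    exact ⟨ξ, hξ, F, h, by rw [← e, add_sub_cancel_left]; exact hy2⟩
  choose ξ hξ Fca hξb hξa using hF
  let Bc : Matrix (Fin nc) (Fin mc) ℝ := fun i j => bu.repr (b (xc i)) (Sum.inr (Sum.inr j))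
  have hAc' : ∀ i, a' (xc i) - ∑ j, Bc i j • ∑ k, Fca j k • xa k ∈
      span ℝ (Set.range xc) ⊔ (LinearMap.ker d).map c := by
    intro i
    -- Subtracting the right combination of the `ξ j` cancels the inputs $u_c$. Then `ζ` lies in
    -- `N`, so its derivative has no `xa` part, and that of `xc i` is the one carried by the `ξ j`.
    set ζ := xc i - ∑ j, Bc i j • ξ j with hζ
    have h1 : ζ ∈ span ℝ (Set.range xc) :=
      sub_mem (subset_span ⟨i, rfl⟩) (sum_mem fun j _ => smul_mem _ _ (hξ j))
    have h2 : b ζ ∈ LinearMap.range d := by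
      refine hN' _ ?_
      rintro (j | j)
      · exact hbc ζ h1 j
      · have h3 : ∀ k, bu.repr (b (ξ k)) (Sum.inr (Sum.inr j)) = if k = j then 1 else 0 := by
          intro k
          have h4 := hN _ (hξb k) (Sum.inr j)
          rw [map_sub, Finsupp.sub_apply, sub_eq_zero] at h4
          rw [h4, Basis.repr_self, Finsupp.single_apply]
          simp
        simp [hζ, h3, Bc]
    have h3 := S.map_of_mem_span_xc ζ h1 h2
    have h4 : a' (xc i) - ∑ j, Bc i j • ∑ k, Fca j k • xa k =
        a' ζ + ∑ j, Bc i j • (a' (ξ j) - ∑ k, Fca j k • xa k) := by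
      simp only [hζ, map_sub, map_sum, map_smul, smul_sub, Finset.sum_sub_distrib]
      abel
    rw [h4]
    exact add_mem h3 (sum_mem fun j _ => smul_mem _ _ (hξa j))
  choose Ac Hcb Hcd hAc using fun i => hXY xc _ (hAc' i)
  -- rows of subsystem (d)
  have hd' : ∀ i k, ∃ h : Fin md → ℝ, if k + 1 < q i then
      ∑ j, h j • xd j 0 = a' (xd i k) - xd i (k + 1) else h = 0 := by
    intro i k
    split_ifs with hk
    · exact (mem_span_range_iff_exists_fun ℝ).1 (S.map_xd i k hk)
    · exact ⟨0, rfl⟩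
  choose Hdd hHdd using hd'
  -- At the end of a chain the whole derivative is put into the feedback, and `Hdd` is zero there.
  let F : Matrix (Fin md) (SCBState na nc l q) ℝ := fun i r => bx.repr (a' (xd i (q i - 1))) r
  let B0 : Matrix (SCBState na nc l q) (Fin m₀) ℝ := fun r j => bu.repr (b (bx r)) (Sum.inl j)
  let C0 : Matrix (Fin m₀) (SCBState na nc l q) ℝ := fun j r => bx.repr (c (bp (Sum.inl j))) r
  let Φ : SCBData m₀ na nc mc l q :=
    { Aa := Aa, Hab := Hab, Had := Had
      Hbb := fun r => Hbb r.1 r.2, Hbd := fun r => Hbd r.1 r.2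
      Ac := Ac, Bc := Bc, Fca := Fca, Hcb := Hcb, Hcd := Hcd
      Fda := fun i r => F i (Sum.inl r)
      Fdb := fun i r => F i (Sum.inr (Sum.inl r))
      Fdc := fun i r => F i (Sum.inr (Sum.inr (Sum.inl r)))
      Fdd := fun i r => F i (Sum.inr (Sum.inr (Sum.inr r)))
      Hdd := fun r => Hdd r.1 r.2
      B0a := fun r => B0 (Sum.inl r)
      B0b := fun r => B0 (Sum.inr (Sum.inl r))
      B0c := fun r => B0 (Sum.inr (Sum.inr (Sum.inl r)))
      B0d := fun r => B0 (Sum.inr (Sum.inr (Sum.inr r)))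
      C0a := fun i r => C0 i (Sum.inl r)
      C0b := fun i r => C0 i (Sum.inr (Sum.inl r))
      C0c := fun i r => C0 i (Sum.inr (Sum.inr (Sum.inl r)))
      C0d := fun i r => C0 i (Sum.inr (Sum.inr (Sum.inr r))) }
  have hB0 : Φ.B0 = B0 := by
    ext (r | r | r | r) j <;> rfl
  have hC0 : Φ.C0 = C0 := by
    ext j (r | r | r | r) <;> rfl
  refine ⟨na, nc, mc, pb, md, l, q, Φ, bx, bu, bp, S.l_pos, S.q_pos, S.antitone_q,
    ?_, ?_, ?_, ?_⟩
  · intro r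
    have e : ∑ r', (Φ.B0 * Φ.C0) r r' • bx r' =
        ∑ j, bu.repr (b (bx r)) (Sum.inl j) • c (bp (Sum.inl j)) := by
      rw [hB0, hC0, sum_mul_smul]
      exact Finset.sum_congr rfl fun j _ => congrArg _ (bx.sum_repr _)
    rw [ha, ← e]
    simp only [SCBData.toSystem, Matrix.add_apply, add_smul, Finset.sum_add_distrib]
    congr 1
    simp only [Fintype.sum_sum_type, hbx, scbFamily, Sum.elim_inl, Sum.elim_inr]
    rcases r with i | ⟨i, k⟩ | i | ⟨i, k⟩ <;>
      simp only [fromRows_apply_inl, fromRows_apply_inr, fromCols_apply_inl, fromCols_apply_inr,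
        Sum.elim_inl, Sum.elim_inr, Matrix.zero_apply, zero_smul, Finset.sum_const_zero, zero_add,
        SCBData.Ab, SCBData.Ad, Matrix.add_apply, add_smul, Finset.sum_add_distrib,
        sum_mul_chainC_smul S.l_pos, sum_mul_chainC_smul S.q_pos, sum_chainB_mul_smul,
        sum_chainA_smul]
    · exact (hAa i).symm
    · have h1 : (if (k : ℕ) + 1 < l i then xb i (k + 1) else 0) = xb i (k + 1) := by
        split_ifs with h
        · rfl
        · exact (S.xb_eq_zero i _ (not_lt.1 h)).symm
      have h2 : ∑ j, Φ.Hbb ⟨i, k⟩ j • xb j 0 + ∑ j, Φ.Hbd ⟨i, k⟩ j • xd j 0 =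
          a' (xb i k) - xb i (k + 1) := hAb i k
      rw [h1, add_assoc, h2, add_sub_cancel]
    · have h1 : ∑ j, Φ.Ac i j • xc j + (∑ j, Φ.Hcb i j • xb j 0 + ∑ j, Φ.Hcd i j • xd j 0) =
          a' (xc i) - ∑ j, Φ.Bc i j • ∑ k, Φ.Fca j k • xa k := hAc i
      rw [sum_mul_smul, ← sub_eq_iff_eq_add', ← h1]
      abel
    · by_cases h : (k : ℕ) + 1 < q i
      · have h1 : ∑ j, Φ.Hdd ⟨i, k⟩ j • xd j 0 = a' (xd i k) - xd i (k + 1) :=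
          (if_pos h).mp (hHdd i k)
        simp only [if_pos h, if_neg h.ne, h1]
        abel
      · have h' : (k : ℕ) + 1 = q i := by have := k.2; omega
        have h'' : (k : ℕ) = q i - 1 := by omega
        have h1 : ∀ j, Φ.Hdd ⟨i, k⟩ j = 0 := congrFun ((if_neg h).mp (hHdd i k))
        simp only [if_neg h, if_pos h', h1, zero_smul, Finset.sum_const_zero, zero_add, add_zero]
        have h2 := bx.sum_repr (a' (xd i k))
        simp only [Fintype.sum_sum_type, hbx, scbFamily, Sum.elim_inl, Sum.elim_inr] at h2
        simp only [h''] at h2 ⊢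
        exact h2.symm
  · intro r
    rw [← bu.sum_repr (b (bx r))]
    refine Finset.sum_congr rfl fun j _ => congrArg (· • bu j) ?_
    rcases j with j | j
    · rcases r with r | r | r | r <;> rfl
    rcases r with i | ⟨i, k⟩ | i | ⟨i, k⟩
    · rw [hbx]
      exact (hN _ (S.xa_mem i) j).trans (by rcases j with j | j <;> rfl)
    · rw [hbx]
      exact (hN _ (S.xb_mem i k) j).trans (by rcases j with j | j <;> rfl)
    · rw [hbx]
      rcases j with j | j
      · exact hbc _ (subset_span ⟨i, rfl⟩) j
      · rfl
    · rw [hbx]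
      change bu.repr (b (xd i k)) (Sum.inr j) = _
      by_cases h : (k : ℕ) + 1 < q i
      · rw [hN _ (S.xd_mem i k h)]
        rcases j with j | j
        · simp [SCBData.toSystem, chainB, h.ne]
        · rfl
      · have h' : (k : ℕ) + 1 = q i := by have := k.2; omega
        have h'' : (k : ℕ) = q i - 1 := by omega
        have h1 := hN _ (hud i) j
        rw [map_sub, Finsupp.sub_apply, sub_eq_zero] at h1
        rw [h'', h1, Basis.repr_self, Finsupp.single_apply]
        rcases j with j | j <;> simp [SCBData.toSystem, chainB, h']
  · rintro (j | j | j)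
    · rw [← bx.sum_repr (c (bp (Sum.inl j)))]
      refine Finset.sum_congr rfl fun r _ => congrArg (· • bx r) ?_
      rcases r with r | r | r | r <;> rfl
    · rw [hcd]
      simp [Fintype.sum_sum_type, SCBData.toSystem, hbx, scbFamily, sum_chainC_smul S.q_pos]
    · rw [hcb]
      simp [Fintype.sum_sum_type, SCBData.toSystem, hbx, scbFamily, sum_chainC_smul S.l_pos]
  · rintro (j | j | j)
    · rw [hdp0]
      simp [Fintype.sum_sum_type, SCBData.toSystem, Matrix.one_apply]
    · rw [hdp]
      simp [SCBData.toSystem]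
    · rw [hdp]
      simp [SCBData.toSystem]

theorem LTISystem.exists_transformsTo_toSystem {n m p m₀ : ℕ}
    (S : LTISystem (Fin n) (Fin m) (Fin p)) (hD : S.D.rank = m₀)
    (hBD : (fromCols S.Bᵀ S.Dᵀ).rank = m) (hCD : (fromCols S.C S.D).rank = p) :
    ∃ (na nc mc pb md : ℕ) (l : Fin pb → ℕ) (q : Fin md → ℕ) (Φ : SCBData m₀ na nc mc l q)
      (Ts : Matrix (Fin n) (SCBState na nc l q) ℝ)
      (Ti : Matrix (Fin m) (SCBInput m₀ md mc) ℝ)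
      (To : Matrix (Fin p) (SCBOutput m₀ md pb) ℝ),
      (∀ i, 0 < l i) ∧ (∀ i, 0 < q i) ∧ Antitone q ∧ S.TransformsTo Ts Ti To Φ.toSystem := by
  have hd : finrank ℝ (LinearMap.range S.D.vecMulLinear) = m₀ := by
    rw [← hD, Matrix.rank_eq_finrank_span_row, range_vecMulLinear]
  -- The rank conditions on $[B^\top\ D^\top]$ and $[C\ D]$ say that no input and no output is
  -- redundant, i.e. joint surjectivity and joint injectivity on row vectors.
  have hsurj : ∀ w, ∃ x y, S.B.vecMulLinear x + S.D.vecMulLinear y = w := by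
    intro w
    have h1 : LinearMap.range (fromCols S.Bᵀ S.Dᵀ).mulVecLin = ⊤ := by
      refine eq_top_of_finrank_eq ?_
      rw [finrank_fin_fun]
      exact hBD
    obtain ⟨v, hv⟩ : w ∈ LinearMap.range (fromCols S.Bᵀ S.Dᵀ).mulVecLin := h1 ▸ mem_top
    refine ⟨v ∘ Sum.inl, v ∘ Sum.inr, ?_⟩
    rw [← hv, mulVecLin_apply, fromCols_mulVec, mulVec_transpose, mulVec_transpose]
    rfl
  have hinj : ∀ y, S.C.vecMulLinear y = 0 → S.D.vecMulLinear y = 0 → y = 0 := by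
    intro y hc hd
    have h1 : finrank ℝ (LinearMap.range (fromCols S.C S.D).vecMulLinear) = p := by
      conv_rhs => rw [← hCD]
      rw [Matrix.rank_eq_finrank_span_row, range_vecMulLinear]
    have h2 := LinearMap.finrank_range_add_finrank_ker (fromCols S.C S.D).vecMulLinear
    rw [h1, finrank_fin_fun, Nat.add_eq_left, finrank_eq_zero] at h2
    have h3 : y ∈ LinearMap.ker (fromCols S.C S.D).vecMulLinear := by
      rw [LinearMap.mem_ker, vecMulLinear_apply, vecMul_fromCols]
      rw [vecMulLinear_apply] at hc hd
      rw [hc, hd]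
      simp
    rwa [h2, mem_bot] at h3
  obtain ⟨na, nc, mc, pb, md, l, q, Φ, bx, bu, bp, hl, hq, hq', hA, hB, hC, hD⟩ :=
    exists_scbData S.A.vecMulLinear S.B.vecMulLinear S.C.vecMulLinear S.D.vecMulLinear hsurj hinj hd
  exact ⟨na, nc, mc, pb, md, l, q, Φ, covectorTransformation bx, covectorTransformation bu,
    covectorTransformation bp, hl, hq, hq', isNonsingular_covectorTransformation bx,
    isNonsingular_covectorTransformation bu, isNonsingular_covectorTransformation bp,
    mul_covectorTransformation bx bx _ _ hA, mul_covectorTransformation bx bu _ _ hB,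
    mul_covectorTransformation bp bx _ _ hC, mul_covectorTransformation bp bu _ _ hD⟩

end Realization

/-! ### Composition of transformations and the main theorem -/

lemma IsNonsingular.mul {α β γ : Type*} [Fintype α] [Fintype β] [Fintype γ] [DecidableEq α]
    [DecidableEq β] [DecidableEq γ] {T : Matrix α β ℝ} {T' : Matrix β γ ℝ} (h : IsNonsingular T)
    (h' : IsNonsingular T') : IsNonsingular (T * T') := by
  obtain ⟨S, h1, h2⟩ := h
  obtain ⟨S', h1', h2'⟩ := h'
  refine ⟨S' * S, ?_, ?_⟩
  · rw [Matrix.mul_assoc, ← Matrix.mul_assoc T', h1', Matrix.one_mul, h1]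
  · rw [Matrix.mul_assoc, ← Matrix.mul_assoc S, h2, Matrix.one_mul, h2']

lemma LTISystem.TransformsTo.trans {X U Y X' U' Y' X'' U'' Y'' : Type*}
    [Fintype X] [Fintype U] [Fintype Y] [Fintype X'] [Fintype U'] [Fintype Y']
    [Fintype X''] [Fintype U''] [Fintype Y'']
    [DecidableEq X] [DecidableEq U] [DecidableEq Y]
    [DecidableEq X'] [DecidableEq U'] [DecidableEq Y']
    [DecidableEq X''] [DecidableEq U''] [DecidableEq Y'']
    {S : LTISystem X U Y} {S' : LTISystem X' U' Y'} {S'' : LTISystem X'' U'' Y''}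
    {Ts : Matrix X X' ℝ} {Ti : Matrix U U' ℝ} {To : Matrix Y Y' ℝ}
    {Ts' : Matrix X' X'' ℝ} {Ti' : Matrix U' U'' ℝ} {To' : Matrix Y' Y'' ℝ}
    (h : S.TransformsTo Ts Ti To S') (h' : S'.TransformsTo Ts' Ti' To' S'') :
    S.TransformsTo (Ts * Ts') (Ti * Ti') (To * To') S'' where
  state_nonsingular := h.state_nonsingular.mul h'.state_nonsingular
  input_nonsingular := h.input_nonsingular.mul h'.input_nonsingular
  output_nonsingular := h.output_nonsingular.mul h'.output_nonsingular
  eq_A := by rw [← Matrix.mul_assoc, h.eq_A, Matrix.mul_assoc, h'.eq_A, Matrix.mul_assoc]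
  eq_B := by rw [← Matrix.mul_assoc, h.eq_B, Matrix.mul_assoc, h'.eq_B, Matrix.mul_assoc]
  eq_C := by rw [← Matrix.mul_assoc, h.eq_C, Matrix.mul_assoc, h'.eq_C, Matrix.mul_assoc]
  eq_D := by rw [← Matrix.mul_assoc, h.eq_D, Matrix.mul_assoc, h'.eq_D, Matrix.mul_assoc]

theorem mainTheorem1 :
    -- every system admits a transformation to an SCB with the particular structure of `F_dd`
    (∀ (n m p m₀ : ℕ) (S : LTISystem (Fin n) (Fin m) (Fin p)),
      S.D.rank = m₀ →
      (fromCols S.Bᵀ S.Dᵀ).rank = m →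
      (fromCols S.C S.D).rank = p →
      ∃ (na nc mc pb md : ℕ) (l : Fin pb → ℕ) (q : Fin md → ℕ) (Φ : SCBData m₀ na nc mc l q)
        (Ts : Matrix (Fin n) (SCBState na nc l q) ℝ)
        (Ti : Matrix (Fin m) (SCBInput m₀ md mc) ℝ)
        (To : Matrix (Fin p) (SCBOutput m₀ md pb) ℝ),
        (∀ i, 0 < l i) ∧ (∀ i, 0 < q i) ∧ Antitone q ∧
        S.TransformsTo Ts Ti To Φ.toSystem ∧
        IsStrictlyBlockLower Φ.Fdd ∧
        IsBlockLower (Φ.Ad - Φ.Hdd * chainC q)) ∧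
    -- for a system that is already in an SCB, a change of coordinates of subsystem (d) suffices
    (∀ (m₀ na nc mc pb md : ℕ) (l : Fin pb → ℕ) (q : Fin md → ℕ) (Φ : SCBData m₀ na nc mc l q),
      (∀ i, 0 < l i) → (∀ i, 0 < q i) → Antitone q →
      ∃ (Td : Matrix (ChainIdx q) (ChainIdx q) ℝ)
        (Fdd' : Matrix (Fin md) (ChainIdx q) ℝ) (Hdd' : Matrix (ChainIdx q) (Fin md) ℝ)
        (Φ' : SCBData m₀ na nc mc l q),
        IsUnit Td.det ∧
        chainC q * Td = chainC q ∧
        Td⁻¹ * chainB q = chainB q ∧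
        Φ' = { Φ with
          Fdd := Fdd'
          Hdd := Hdd'
          B0d := Td⁻¹ * Φ.B0d
          C0d := Φ.C0d * Td } ∧
        Φ.toSystem.TransformsTo (subsystemDTransformation na nc l Td) 1 1 Φ'.toSystem ∧
        IsStrictlyBlockLower Φ'.Fdd ∧
        IsBlockLower (Φ'.Ad - Φ'.Hdd * chainC q)) := by
  refine ⟨fun n m p m₀ S hD hBD hCD => ?_, fun m₀ na nc mc pb md l q Φ _ hq0 hq =>
    Φ.exists_isStrictlyBlockLower hq0 hq⟩
  obtain ⟨na, nc, mc, pb, md, l, q, Φ, Ts, Ti, To, hl, hq0, hq, hT⟩ :=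
    S.exists_transformsTo_toSystem hD hBD hCD
  obtain ⟨Td, _, _, Φ', _, _, _, _, hT', hF, hL⟩ := Φ.exists_isStrictlyBlockLower hq0 hq
  exact ⟨na, nc, mc, pb, md, l, q, Φ', _, _, _, hl, hq0, hq, hT.trans hT', hF, hL⟩
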